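/- Let $n\ge 1$. For a topological group $G$, a torus in $G$ is a subgroup isomorphic, as a topological group, to $U(1)^k$ for some $k\ge 0$; a maximal torus is a torus not properly contained in another torus; and the Weyl group of $G$ with respect to a maximal torus $T$ is $W(G)=N(T)/T$, where $N(T)=\{g\in G\mid gTg^{-1}=T\}$. Let $Sp(n)$ denote the group of $n\times n$ quaternionic matrices $A$ with $AA^*=A^*A=I$. Then, for every choice of the maximal torus, $$|W(SO(2n+1))|=|W(Sp(n))|=2^n\,n!,\qquad |W(SO(2n))|=2^{n-1}\,n!.$$ Moreover, these Weyl groups are the following groups of signed permutations. Put $R(\theta)=\begin{pmatrix}\cos\theta&\sin\theta\\-\sin\theta&\cos\theta\end{pmatrix}$. The subgroups $$\{\mathrm{diag}(R(\theta_1),\dots,R(\theta_n))\}\subset SO(2n),\quad \{\mathrm{diag}(R(\theta_1),\dots,R(\theta_n),1)\}\subset SO(2n+1),\quad \{\mathrm{diag}(e^{\theta_1\mathbf i},\dots,e^{\theta_n\mathbf i})\}\subset Sp(n)$$ ($\theta_1,\dots,\theta_n\in\mathbb R$) are maximal tori. Let $T$ be this torus. For $SO(2n)$ and $SO(2n+1)$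 let $H_i$ be the block diagonal matrix with $i$-th $2\times 2$ block $\begin{pmatrix}0&1\\-1&0\end{pmatrix}$ and all other entries zero; for $Sp(n)$ let $H_i$ be the diagonal matrix with $\mathbf i$ in position $(i,i)$ and all other entries zero. Then $gT\star X=gXg^{-1}$ is a well-defined faithful action of $N(T)/T$ on the set $\{\pm H_1,\dots,\pm H_n\}$. For $G\in\{SO(2n+1),Sp(n)\}$ the permutations of this set induced by the elements of $W(G)$ are exactly the signed permutations, that is, the permutations $\pi$ with $\pi(-X)=-\pi(X)$ for all $X$; for $G=SO(2n)$ they are exactly the signed permutations $\pi$ for which the number of indices $i$ with $\pi(H_i)\in\{-H_1,\dots,-H_n\}$ is even. -/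

import Mathlib

open scoped Quaternion Nat

noncomputable section

/-! ### Maximal tori and Weyl groups of topological groups -/

/-- A subgroup `T` of a topological group is a torus if it is isomorphic, as a topological group,
to a finite power of the circle group. -/
def IsTorus {G : Type*} [Group G] [TopologicalSpace G] (T : Subgroup G) : Prop :=
  ∃ k : ℕ, Nonempty (T ≃ₜ* (Fin k → Circle))

/-- A maximal torus is a torus that is not properly contained in another torus. -/
def IsMaximalTorus {G : Type*} [Group G] [TopologicalSpace G] (T : Subgroup G) : Prop :=
  Maximal IsTorus T

/-- The Weyl group `W(G) = N(T) / T`. -/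
abbrev WeylGroup {G : Type*} [Group G] (T : Subgroup G) : Type _ :=
  Subgroup.normalizer (T : Set G) ⧸ T.subgroupOf (Subgroup.normalizer (T : Set G))

/-! ### Signed permutations of `{±H₁, …, ±Hₙ}` -/

section SignedPermutations

/-- The set `{±H₁, …, ±Hₙ}`. -/
def plusMinus {V : Type*} [Neg V] {n : ℕ} (H : Fin n → V) : Set V :=
  {X | ∃ i, X = H i ∨ X = -H i}

/-- The signed permutations of `{±H₁, …, ±Hₙ}`: the permutations `π` with `π (-X) = -π X`. -/
def signedPerms {V : Type*} [Neg V] {n : ℕ} (H : Fin n → V) : Set (Equiv.Perm (plusMinus H)) :=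
  {π | ∀ X Y : plusMinus H, (Y : V) = -(X : V) → (π Y : V) = -(π X : V)}

/-- The indices `i` that become negative under `π`, that is, `π (H i) = -H j` for some `j`. -/
def negativeIndices {V : Type*} [Neg V] {n : ℕ} (H : Fin n → V) (π : Equiv.Perm (plusMinus H)) :
    Set (Fin n) :=
  {i | ∃ j, (π ⟨H i, i, Or.inl rfl⟩ : V) = -H j}

/-- The signed permutations under which an even number of indices become negative. -/
def evenSignedPerms {V : Type*} [Neg V] {n : ℕ} (H : Fin n → V) :
    Set (Equiv.Perm (plusMinus H)) :=
  {π | π ∈ signedPerms H ∧ Even (negativeIndices H π).ncard}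

/-- For a group `G` of matrices, included by `ι` into the ring `M` of all matrices, the Weyl group
`N(T) / T` acts by `gT ⋆ X = Ad_g X = g X g⁻¹` on the set `{±H₁, …, ±Hₙ}`, faithfully, and the
permutations of the set arising in this way are exactly those in `P`. -/
def WeylGroupActsAs {G M : Type*} [Group G] [Ring M] (ι : G →* M) (T : Subgroup G) {n : ℕ}
    (H : Fin n → M) (P : Set (Equiv.Perm (plusMinus H))) : Prop :=
  ∃ ρ : WeylGroup T →* Equiv.Perm (plusMinus H),
    (∀ (g : Subgroup.normalizer (T : Set G)) (X : plusMinus H),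
      (ρ (QuotientGroup.mk g) X : M) = ι (g : G) * (X : M) * ι ((g : G)⁻¹)) ∧
    Function.Injective ρ ∧ Set.range ρ = P

end SignedPermutations

/-! ### The groups `SO(N)` and `Sp(n)` -/

/-- `SO(N)`. -/
abbrev SO (N : ℕ) : Type := Matrix.specialOrthogonalGroup (Fin N) ℝ

/-- `Sp(n)`: the `n × n` quaternionic matrices `A` with `A A* = A* A = 1`. -/
abbrev Sp (n : ℕ) : Type := unitary (Matrix (Fin n) (Fin n) ℍ[ℝ])

/-! ### Standard maximal tori and the standard bases of their Lie algebras -/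

/-- The rotation block `exp (0 t; -t 0)`. -/
def rotBlock (t : ℝ) : Matrix (Fin 2) (Fin 2) ℝ :=
  !![Real.cos t, Real.sin t; -Real.sin t, Real.cos t]

/-- The position `a` in the `i`-th `2 × 2` block corresponds to the index `2 i + a`. -/
def evenIdx (n : ℕ) : Fin 2 × Fin n ≃ Fin (2 * n) :=
  ((Equiv.prodComm _ _).trans finProdFinEquiv).trans (finCongr (Nat.mul_comm n 2))

/-- As `evenIdx`, with one further last index `2 n`. -/
def oddIdx (n : ℕ) : (Fin 2 × Fin n) ⊕ Fin 1 ≃ Fin (2 * n + 1) :=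
  ((evenIdx n).sumCongr (Equiv.refl (Fin 1))).trans finSumFinEquiv

/-- The block diagonal matrix `diag (B₁, …, Bₙ)` of size `2 n`. -/
def evenDiag {n : ℕ} (B : Fin n → Matrix (Fin 2) (Fin 2) ℝ) :
    Matrix (Fin (2 * n)) (Fin (2 * n)) ℝ :=
  Matrix.reindex (evenIdx n) (evenIdx n) (Matrix.blockDiagonal B)

/-- The block diagonal matrix `diag (B₁, …, Bₙ, c)` of size `2 n + 1`. -/
def oddDiag {n : ℕ} (B : Fin n → Matrix (Fin 2) (Fin 2) ℝ) (c : ℝ) :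
    Matrix (Fin (2 * n + 1)) (Fin (2 * n + 1)) ℝ :=
  Matrix.reindex (oddIdx n) (oddIdx n)
    (Matrix.fromBlocks (Matrix.blockDiagonal B) 0 0 (Matrix.diagonal fun _ => c))

theorem evenIdx_val (n : ℕ) (a : Fin 2) (i : Fin n) :
    (evenIdx n (a, i) : ℕ) = 2 * (i : ℕ) + (a : ℕ) := by
  simp [evenIdx, finProdFinEquiv]; ring

theorem rotBlock_add (s t : ℝ) : rotBlock s * rotBlock t = rotBlock (s + t) := by
  ext i j
  fin_cases i <;> fin_cases j <;>
    simp [rotBlock, Matrix.mul_apply, Fin.sum_univ_two, Real.cos_add, Real.sin_add] <;> ring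

theorem rotBlock_zero : rotBlock 0 = 1 := by
  ext i j
  fin_cases i <;> fin_cases j <;> simp [rotBlock]

theorem rotBlock_transpose (t : ℝ) : (rotBlock t).transpose = rotBlock (-t) := by
  ext i j
  fin_cases i <;> fin_cases j <;> simp [rotBlock]

theorem rotBlock_det (t : ℝ) : (rotBlock t).det = 1 := by
  simp [rotBlock, Matrix.det_fin_two]
  nlinarith [Real.sin_sq_add_cos_sq t]

theorem evenDiag_mul {n : ℕ} (B C : Fin n → Matrix (Fin 2) (Fin 2) ℝ) :
    evenDiag B * evenDiag C = evenDiag fun i => B i * C i := by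
  simp [evenDiag, Matrix.blockDiagonal_mul, Matrix.submatrix_mul_equiv]

theorem oddDiag_mul {n : ℕ} (B C : Fin n → Matrix (Fin 2) (Fin 2) ℝ) (c d : ℝ) :
    oddDiag B c * oddDiag C d = oddDiag (fun i => B i * C i) (c * d) := by
  simp [oddDiag, Matrix.blockDiagonal_mul, Matrix.submatrix_mul_equiv, Matrix.fromBlocks_multiply,
    Matrix.diagonal_mul_diagonal]

theorem evenDiag_one {n : ℕ} : evenDiag (fun _ : Fin n => 1) = 1 := by
  have h : Matrix.blockDiagonal (fun _ : Fin n => (1 : Matrix (Fin 2) (Fin 2) ℝ)) = 1 :=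
    Matrix.blockDiagonal_one
  simp [evenDiag, h]

theorem oddDiag_one {n : ℕ} : oddDiag (fun _ : Fin n => 1) 1 = 1 := by
  have h : Matrix.blockDiagonal (fun _ : Fin n => (1 : Matrix (Fin 2) (Fin 2) ℝ)) = 1 :=
    Matrix.blockDiagonal_one
  simp [oddDiag, h]

theorem evenDiag_rotBlock_mem {n : ℕ} (θ : Fin n → ℝ) :
    evenDiag (fun i => rotBlock (θ i)) ∈ Matrix.specialOrthogonalGroup (Fin (2 * n)) ℝ := by
  rw [Matrix.mem_specialOrthogonalGroup_iff, Matrix.mem_orthogonalGroup_iff]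
  constructor
  · have h : (evenDiag fun i => rotBlock (θ i)).transpose = evenDiag fun i => rotBlock (-θ i) := by
      simp [evenDiag, Matrix.transpose_submatrix, Matrix.blockDiagonal_transpose,
        rotBlock_transpose]
    rw [h, evenDiag_mul]
    simp [rotBlock_add, rotBlock_zero, evenDiag_one]
  · rw [evenDiag, Matrix.det_reindex_self, Matrix.det_blockDiagonal]
    simp [rotBlock_det]

theorem oddDiag_rotBlock_mem {n : ℕ} (θ : Fin n → ℝ) :
    oddDiag (fun i => rotBlock (θ i)) 1 ∈
      Matrix.specialOrthogonalGroup (Fin (2 * n + 1)) ℝ := by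
  rw [Matrix.mem_specialOrthogonalGroup_iff, Matrix.mem_orthogonalGroup_iff]
  constructor
  · have h : (oddDiag (fun i => rotBlock (θ i)) 1).transpose =
        oddDiag (fun i => rotBlock (-θ i)) 1 := by
      simp [oddDiag, Matrix.transpose_submatrix, Matrix.fromBlocks_transpose,
        Matrix.blockDiagonal_transpose, rotBlock_transpose]
    rw [h, oddDiag_mul]
    simp [rotBlock_add, rotBlock_zero, oddDiag_one]
  · rw [oddDiag, Matrix.det_reindex_self, Matrix.det_fromBlocks_zero₂₁, Matrix.det_blockDiagonal]
    simp [rotBlock_det]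

/-- The standard maximal torus of `SO(2n)`: the matrices `diag (R(θ₁), …, R(θₙ))`, where `R(θ)` is
the rotation block. -/
def evenTorus (n : ℕ) : Subgroup (SO (2 * n)) where
  carrier := {g | ∃ θ : Fin n → ℝ,
    (g : Matrix (Fin (2 * n)) (Fin (2 * n)) ℝ) = evenDiag fun i => rotBlock (θ i)}
  one_mem' := ⟨0, by simp [rotBlock_zero, evenDiag_one]⟩
  mul_mem' := by
    rintro a b ⟨θ, ha⟩ ⟨η, hb⟩
    exact ⟨θ + η, by simp [ha, hb, evenDiag_mul, rotBlock_add]⟩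
  inv_mem' := by
    rintro a ⟨θ, ha⟩
    refine ⟨-θ, ?_⟩
    have h : a * ⟨_, evenDiag_rotBlock_mem (-θ)⟩ = 1 := by
      apply Subtype.ext
      simp [ha, evenDiag_mul, rotBlock_add, rotBlock_zero, evenDiag_one]
    rw [inv_eq_of_mul_eq_one_right h]

/-- The standard maximal torus of `SO(2n+1)`: the matrices `diag (R(θ₁), …, R(θₙ), 1)`. -/
def oddTorus (n : ℕ) : Subgroup (SO (2 * n + 1)) where
  carrier := {g | ∃ θ : Fin n → ℝ,
    (g : Matrix (Fin (2 * n + 1)) (Fin (2 * n + 1)) ℝ) = oddDiag (fun i => rotBlock (θ i)) 1}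
  one_mem' := ⟨0, by simp [rotBlock_zero, oddDiag_one]⟩
  mul_mem' := by
    rintro a b ⟨θ, ha⟩ ⟨η, hb⟩
    exact ⟨θ + η, by simp [ha, hb, oddDiag_mul, rotBlock_add]⟩
  inv_mem' := by
    rintro a ⟨θ, ha⟩
    refine ⟨-θ, ?_⟩
    have h : a * ⟨_, oddDiag_rotBlock_mem (-θ)⟩ = 1 := by
      apply Subtype.ext
      simp [ha, oddDiag_mul, rotBlock_add, rotBlock_zero, oddDiag_one]
    rw [inv_eq_of_mul_eq_one_right h]

/-- The unit quaternion `e^{t i} = cos t + i sin t`. -/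
def expI (t : ℝ) : ℍ[ℝ] := ⟨Real.cos t, Real.sin t, 0, 0⟩

theorem expI_add (s t : ℝ) : expI s * expI t = expI (s + t) := by
  ext
  · rw [Quaternion.re_mul]; simp [expI, Real.cos_add]
  · rw [Quaternion.imI_mul]; simp [expI, Real.sin_add]; ring
  · rw [Quaternion.imJ_mul]; simp [expI]
  · rw [Quaternion.imK_mul]; simp [expI]

theorem expI_zero : expI 0 = 1 := by
  ext <;> simp [expI]

/-- The standard maximal torus of `Sp(n)`: the matrices `diag (e^{θ₁ i}, …, e^{θₙ i})`. -/
def spTorus (n : ℕ) : Subgroup (Sp n) where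
  carrier := {g | ∃ θ : Fin n → ℝ,
    (g : Matrix (Fin n) (Fin n) ℍ[ℝ]) = Matrix.diagonal fun i => expI (θ i)}
  one_mem' := ⟨0, by simp [expI_zero]⟩
  mul_mem' := by
    rintro a b ⟨θ, ha⟩ ⟨η, hb⟩
    exact ⟨θ + η, by simp [ha, hb, Matrix.diagonal_mul_diagonal, expI_add]⟩
  inv_mem' := by
    rintro a ⟨θ, ha⟩
    refine ⟨-θ, ?_⟩
    have h1 : (a : Matrix (Fin n) (Fin n) ℍ[ℝ]) * Matrix.diagonal (fun i => expI ((-θ) i)) = 1 := by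
      simp [ha, Matrix.diagonal_mul_diagonal, expI_add, expI_zero]
    have h2 : ((a⁻¹ : Sp n) : Matrix (Fin n) (Fin n) ℍ[ℝ]) * a = 1 := by
      rw [← Submonoid.coe_mul, inv_mul_cancel]; rfl
    exact left_inv_eq_right_inv h2 h1

/-- `Hᵢ ∈ so(2n)`: the block `(0 1; -1 0)` in the `i`-th place, and zeros elsewhere. -/
def evenH (n : ℕ) (i : Fin n) : Matrix (Fin (2 * n)) (Fin (2 * n)) ℝ :=
  evenDiag (Pi.single i !![0, 1; -1, 0])

/-- `Hᵢ ∈ so(2n+1)`: the block `(0 1; -1 0)` in the `i`-th place, and zeros elsewhere. -/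
def oddH (n : ℕ) (i : Fin n) : Matrix (Fin (2 * n + 1)) (Fin (2 * n + 1)) ℝ :=
  oddDiag (Pi.single i !![0, 1; -1, 0]) 0

/-- `Hᵢ ∈ sp(n)`: the quaternion `i` in the `i`-th diagonal place, and zeros elsewhere. -/
def spH (n : ℕ) (i : Fin n) : Matrix (Fin n) (Fin n) ℍ[ℝ] :=
  Matrix.diagonal (Pi.single i ⟨0, 1, 0, 0⟩)

end

/-! The Lie theory is replaced by algebra with the generators `H i`. They are pairwise orthogonal
(`H i * H j = 0` for `i ≠ j`) and satisfy `H i ^ 3 = -H i`, so exponentials of their combinations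
are given by the polynomial formula `circleExp`, which parametrizes the standard torus `T` by `Fin n
→ Circle`. For `t ∈ T` with angles `θ i`, `t - t⁻¹` is twice the sum of the `sin (θ i) • H i`. This
recovers the span of the `H i` from `T` without differentiation, so conjugation by an element of
`N(T)` preserves that span. It also preserves the relations among the generators, and these force
each `H i` to go to some `±H j` (`exists_signed_of_mem_normalizer`). An element commuting with every
`H i` lies in `T`. This gives both the maximality of `T` and the faithfulness of the action of
`N(T)/T`. `IsTorusFrame` collects what is needed, so the three families share one argument.

It remains to decide which signed permutations occur. In the orthogonal groups, permuting the planes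
has determinant `1` and reversing one `H i` by a reflection of its plane has determinant `-1`. In
`SO(2n)` the product of the signs must therefore be `1`, because any two realizations differ by an
element of determinant `1`. In `SO(2n+1)` the extra coordinate absorbs the determinant. In `Sp(n)`
conjugation by the quaternion `j` reverses `i`, with no further condition.

An arbitrary maximal torus is handled by conjugating it into the standard one. Its elements commute,
so suitable symmetric operators built from `t + t⁻¹` and `t - t⁻¹` have a common eigenvector. This
yields invariant planes with rotations in the real case (`exists_fixed_or_rotationPair`) and
eigenvectors with complex eigenvalues in the quaternionic case (`exists_sp_eigenvector`). In the
real case the existence of square roots in a torus rules out the eigenvalue `-1` on a common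
eigenline. Maximality then makes the torus a conjugate of the standard one, with a Weyl group of the
same order, and the orders follow by counting signed permutations. -/

/-! ### Tori as images of powers of the circle group -/

section Tori

variable {G : Type*} [Group G] [TopologicalSpace G]

/-- The image of an injective continuous homomorphism from a power of the circle is a torus. -/
theorem isTorus_of_injective_hom [T2Space G] {T : Subgroup G} {k : ℕ}
    (f : (Fin k → Circle) →* G) (hc : Continuous f) (hf : Function.Injective f)
    (hT : f.range = T) : IsTorus T := by
  subst hT
  let e := MonoidHom.ofInjective hf
  have he : Continuous e := hc.subtype_mk _
  -- A continuous bijection from a compact space to a Hausdorff space is a homeomorphism.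
  exact ⟨k, ⟨(ContinuousMulEquiv.mk'
    (Continuous.homeoOfEquivCompactToT2 (f := e.toEquiv) he) (map_mul e)).symm⟩⟩

/-- Tori are commutative. -/
theorem IsTorus.commute {T : Subgroup G} (hT : IsTorus T) {s t : G} (hs : s ∈ T) (ht : t ∈ T) :
    s * t = t * s := by
  obtain ⟨k, ⟨e⟩⟩ := hT
  have h : (⟨s, hs⟩ : T) * ⟨t, ht⟩ = ⟨t, ht⟩ * ⟨s, hs⟩ := by
    apply e.injective
    rw [map_mul, map_mul, mul_comm]
  exact congrArg Subtype.val h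

theorem Circle.exists_mul_self_eq (z : Circle) : ∃ w : Circle, w * w = z :=
  ⟨Circle.exp (Complex.arg z / 2), by rw [← Circle.exp_add, add_halves, Circle.exp_arg]⟩

/-- Every element of a torus is the square of an element of the torus. -/
theorem IsTorus.exists_mul_self_eq {T : Subgroup G} (hT : IsTorus T) {t : G} (ht : t ∈ T) :
    ∃ s ∈ T, s * s = t := by
  obtain ⟨k, ⟨e⟩⟩ := hT
  choose w hw using fun i => Circle.exists_mul_self_eq (e ⟨t, ht⟩ i)
  refine ⟨e.symm w, (e.symm w).2, ?_⟩
  have h : e.symm w * e.symm w = ⟨t, ht⟩ := by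
    rw [← map_mul, ContinuousMulEquiv.symm_apply_eq]
    exact funext hw
  exact congrArg Subtype.val h

/-- Conjugates of tori are tori. -/
theorem IsTorus.map_conj [T2Space G] [ContinuousMul G] {T : Subgroup G} (hT : IsTorus T) (g : G) :
    IsTorus (T.map (MulAut.conj g).toMonoidHom) := by
  obtain ⟨k, ⟨e⟩⟩ := hT
  refine isTorus_of_injective_hom
    ((MulAut.conj g).toMonoidHom.comp (T.subtype.comp e.symm.toMulEquiv.toMonoidHom)) ?_ ?_ ?_
  · change Continuous fun x => g * (e.symm x : G) * g⁻¹
    exact (continuous_const.mul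
      (continuous_subtype_val.comp e.symm.continuous)).mul continuous_const
  · exact (MulAut.conj g).injective.comp (T.subtype_injective.comp e.symm.injective)
  · ext x
    simp only [MonoidHom.mem_range, MonoidHom.comp_apply, Subgroup.mem_map]
    constructor
    · rintro ⟨y, rfl⟩
      exact ⟨_, (e.symm y).2, rfl⟩
    · rintro ⟨t, ht, rfl⟩
      refine ⟨e ⟨t, ht⟩, congrArg (MulAut.conj g).toMonoidHom ?_⟩
      exact congrArg Subtype.val (e.symm_apply_apply ⟨t, ht⟩)

/-- Isomorphic pairs have Weyl groups of the same order. -/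
theorem card_weylGroup_map {G : Type*} [Group G] (T : Subgroup G) (f : G ≃* G) :
    Nat.card (WeylGroup (T.map f.toMonoidHom)) = Nat.card (WeylGroup T) := by
  change (T.map f.toMonoidHom).relIndex _ = T.relIndex _
  rw [← Subgroup.map_equiv_normalizer_eq]
  exact Subgroup.relIndex_map_map_of_injective _ _ f.injective

/-- If every torus is conjugate to a subgroup of the torus `T₀`, then all maximal tori have Weyl
groups of the same order as `T₀`. -/
theorem card_weylGroup_eq_of_conj [T2Space G] [ContinuousMul G] {T₀ : Subgroup G}
    (h₀ : IsTorus T₀)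
    (hconj : ∀ T : Subgroup G, IsTorus T → ∃ g : G, ∀ t ∈ T, g⁻¹ * t * g ∈ T₀)
    {T : Subgroup G} (hT : IsMaximalTorus T) :
    Nat.card (WeylGroup T) = Nat.card (WeylGroup T₀) := by
  obtain ⟨g, hg⟩ := hconj T hT.prop
  have hle : T ≤ T₀.map (MulAut.conj g).toMonoidHom := fun t ht =>
    ⟨_, hg t ht, by simp [mul_assoc]⟩
  -- The conjugate of `T₀` is itself a torus, so maximality of `T` turns the inclusion into an
  -- equality.
  have h : T = T₀.map (MulAut.conj g).toMonoidHom :=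
    le_antisymm hle (hT.le_of_ge (h₀.map_conj g) hle)
  rw [h, card_weylGroup_map]

end Tori

/-! ### Groups of matrices with a torus spanned by commuting generators -/

section Frame

variable {G M : Type*} [Group G] [Ring M] [Algebra ℝ M] {n : ℕ}

/-- The product of the exponentials `exp (θᵢ Hᵢ)` with `zᵢ = e^{iθᵢ}`, for pairwise orthogonal
`Hᵢ` with `Hᵢ³ = -Hᵢ`. -/
noncomputable def circleExp (H : Fin n → M) (z : Fin n → Circle) : M :=
  1 + ∑ i, ((z i : ℂ).im • H i + (1 - (z i : ℂ).re) • (H i * H i))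

/-- `T` consists of the elements of `G` of the form `∏ exp (θᵢ Hᵢ)` and is its own centralizer. -/
structure IsTorusFrame (ι : G →* M) (T : Subgroup G) (H : Fin n → M) : Prop where
  injective : Function.Injective ι
  mul_eq_zero : ∀ i j, i ≠ j → H i * H j = 0
  cube : ∀ i, H i * H i * H i = -H i
  ne_zero : ∀ i, H i ≠ 0
  mem_iff : ∀ g, g ∈ T ↔ ∃ z, ι g = circleExp H z
  exists_eq : ∀ z, ∃ g, ι g = circleExp H z
  centralizer : ∀ g, (∀ i, ι g * H i = H i * ι g) → g ∈ T

namespace IsTorusFrame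

variable {ι : G →* M} {T : Subgroup G} {H : Fin n → M}

theorem sq_ne_zero (h : IsTorusFrame ι T H) (i : Fin n) : H i * H i ≠ 0 := by
  intro h0
  have := h.cube i
  rw [h0, zero_mul, zero_eq_neg] at this
  exact h.ne_zero i this

theorem sum_mul (h : IsTorusFrame ι T H) (s : Fin n → ℝ) (k : Fin n) :
    (∑ j, s j • H j) * H k = s k • (H k * H k) := by
  rw [Finset.sum_mul, Finset.sum_eq_single k]
  · rw [smul_mul_assoc]
  · intro j _ hj
    rw [smul_mul_assoc, h.mul_eq_zero j k hj, smul_zero]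
  · simp

theorem sum_mul_sum (h : IsTorusFrame ι T H) (s t : Fin n → ℝ) :
    (∑ j, s j • H j) * ∑ j, t j • H j = ∑ j, (s j * t j) • (H j * H j) := by
  rw [Finset.mul_sum]
  refine Finset.sum_congr rfl fun j _ => ?_
  rw [mul_smul_comm, h.sum_mul, smul_smul, mul_comm]

/-- Right multiplication by `H k` kills every term except the `k`-th, and `H k * H k` is nonzero
because its product with `H k` is `-H k`. -/
theorem coeff_eq (h : IsTorusFrame ι T H) {s t : Fin n → ℝ}
    (hst : ∑ j, s j • H j = ∑ j, t j • H j) : s = t := by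
  funext k
  have := congrArg (· * H k) hst
  simp only [h.sum_mul] at this
  exact smul_left_injective ℝ (h.sq_ne_zero k) this

theorem eq_iff_of_sign (h : IsTorusFrame ι T H) {i j : Fin n} {u v : ℤˣ}
    (huv : u • H i = v • H j) : i = j ∧ u = v := by
  have key : ∀ w : ℤˣ, ∀ k, w • H k = ∑ l, (Pi.single k (((w : ℤ) : ℝ)) : Fin n → ℝ) l • H l := by
    intro w k
    rw [Finset.sum_eq_single k]
    · rcases Int.units_eq_one_or w with rfl | rfl <;> simp
    · intro l _ hl
      simp [Pi.single_eq_of_ne hl]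
    · simp
  rw [key, key] at huv
  have h2 := h.coeff_eq huv
  have hij : i = j := by
    by_contra hij
    have := congrFun h2 i
    rw [Pi.single_eq_same, Pi.single_eq_of_ne hij] at this
    rcases Int.units_eq_one_or u with rfl | rfl <;> simp at this
  subst hij
  refine ⟨rfl, ?_⟩
  have := congrFun h2 i
  simp only [Pi.single_eq_same, Int.cast_inj] at this
  exact Units.ext this

/-- By the cubic relation `-(H i * H i)` is an idempotent on which `H i` acts as an imaginary unit,
so each index carries its own copy of complex multiplication. Orthogonality removes the cross terms.
-/
theorem circleExp_mul (h : IsTorusFrame ι T H) (z w : Fin n → Circle) :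
    circleExp H z * circleExp H w = circleExp H (z * w) := by
  have hsq : ∀ i, H i * (H i * H i) = -H i := fun i => by rw [← mul_assoc, h.cube]
  have h4 : ∀ i, H i * H i * (H i * H i) = -(H i * H i) := fun i => by
    rw [← mul_assoc, h.cube, neg_mul]
  have key : (∑ i, ((z i : ℂ).im • H i + (1 - (z i : ℂ).re) • (H i * H i))) *
      (∑ i, ((w i : ℂ).im • H i + (1 - (w i : ℂ).re) • (H i * H i))) =
      ∑ i, ((z i : ℂ).im • H i + (1 - (z i : ℂ).re) • (H i * H i)) *
        ((w i : ℂ).im • H i + (1 - (w i : ℂ).re) • (H i * H i)) := by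
    rw [Finset.sum_mul_sum]
    refine Finset.sum_congr rfl fun i _ => ?_
    rw [Finset.sum_eq_single i]
    · intro j _ hj
      have hij := h.mul_eq_zero i j hj.symm
      have h1 : H i * (H j * H j) = 0 := by rw [← mul_assoc, hij, zero_mul]
      have h2 : H i * H i * H j = 0 := by rw [mul_assoc, hij, mul_zero]
      have h3 : H i * H i * (H j * H j) = 0 := by rw [← mul_assoc, h2, zero_mul]
      simp [add_mul, mul_add, hij, h1, h2, h3]
    · simp
  unfold circleExp
  rw [add_mul, mul_add, mul_add, key]
  simp only [one_mul, mul_one]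
  rw [add_assoc, ← Finset.sum_add_distrib, ← Finset.sum_add_distrib]
  congr 1
  refine Finset.sum_congr rfl fun i _ => ?_
  simp only [add_mul, mul_add, smul_mul_assoc, mul_smul_comm, hsq, h4, h.cube,
    Pi.mul_apply, Circle.coe_mul, Complex.mul_re, Complex.mul_im]
  module

theorem circleExp_one (H : Fin n → M) : circleExp H 1 = 1 := by
  simp [circleExp]

/-- Inversion conjugates each `z i`, so the even terms cancel and only the part linear in the `H i`
survives. This is the substitute for differentiating at the identity. -/
theorem circleExp_sub_inv (H : Fin n → M) (z : Fin n → Circle) :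
    circleExp H z - circleExp H z⁻¹ = (2 : ℝ) • ∑ i, (z i : ℂ).im • H i := by
  unfold circleExp
  rw [add_sub_add_left_eq_sub, ← Finset.sum_sub_distrib, Finset.smul_sum]
  refine Finset.sum_congr rfl fun i _ => ?_
  rw [Pi.inv_apply, Circle.coe_inv_eq_conj, Complex.conj_re, Complex.conj_im]
  module

/-- The parametrization of the torus. -/
noncomputable def hom (h : IsTorusFrame ι T H) : (Fin n → Circle) →* G where
  toFun z := (h.exists_eq z).choose
  map_one' := h.injective (by rw [(h.exists_eq 1).choose_spec, map_one, circleExp_one])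
  map_mul' z w := h.injective (by
    rw [(h.exists_eq _).choose_spec, map_mul, (h.exists_eq _).choose_spec,
      (h.exists_eq _).choose_spec, h.circleExp_mul])

theorem map_hom (h : IsTorusFrame ι T H) (z : Fin n → Circle) : ι (h.hom z) = circleExp H z :=
  (h.exists_eq z).choose_spec

theorem range_hom (h : IsTorusFrame ι T H) : h.hom.range = T := by
  ext g
  rw [h.mem_iff]
  exact ⟨fun ⟨z, hz⟩ => ⟨z, by rw [← hz, h.map_hom]⟩,
    fun ⟨z, hz⟩ => ⟨z, h.injective (by rw [h.map_hom, hz])⟩⟩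

theorem hom_mem (h : IsTorusFrame ι T H) (z : Fin n → Circle) : h.hom z ∈ T :=
  (h.mem_iff _).2 ⟨z, h.map_hom z⟩

theorem exists_hom_eq (h : IsTorusFrame ι T H) {t : G} (ht : t ∈ T) : ∃ z, h.hom z = t := by
  rw [← h.range_hom] at ht
  exact ht

theorem map_hom_sub_inv (h : IsTorusFrame ι T H) (z : Fin n → Circle) :
    ι (h.hom z) - ι (h.hom z)⁻¹ = (2 : ℝ) • ∑ i, (z i : ℂ).im • H i := by
  rw [← map_inv, h.map_hom, h.map_hom, circleExp_sub_inv]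

theorem injective_hom (h : IsTorusFrame ι T H) : Function.Injective h.hom := by
  rw [injective_iff_map_eq_one]
  intro z hz
  have h1 : circleExp H z = 1 := by rw [← h.map_hom, hz, map_one]
  have him : ∑ i, (z i : ℂ).im • H i = ∑ i, (0 : Fin n → ℝ) i • H i := by
    have := h.map_hom_sub_inv z
    rw [hz, inv_one, sub_self, eq_comm, smul_eq_zero_iff_right two_ne_zero] at this
    simpa using this
  have him' := h.coeff_eq him
  funext k
  -- Once the imaginary parts vanish, a combination of the squares `H i * H i` remains. Writing it
  -- as a product of two combinations of the `H i` makes `sum_mul` applicable after multiplication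
  -- by `H k`.
  have h2 : (∑ i, (1 - (z i : ℂ).re) • H i) * ∑ i, (1 : ℝ) • H i =
      (∑ i, (0 : ℝ) • H i) * ∑ i, (1 : ℝ) • H i := by
    rw [h.sum_mul_sum, h.sum_mul_sum]
    unfold circleExp at h1
    rw [add_eq_left, Finset.sum_add_distrib, him] at h1
    simpa using h1
  have h3 := congrArg (· * H k) h2
  simp only [mul_assoc, h.sum_mul] at h3
  simp only [one_smul, zero_smul, Finset.sum_const_zero, zero_mul, ← mul_assoc, h.sum_mul] at h3
  rw [smul_mul_assoc, smul_eq_zero, h.cube, neg_eq_zero, or_iff_left (h.ne_zero k)] at h3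
  apply Circle.ext
  apply Complex.ext
  · simpa using (sub_eq_zero.1 h3).symm
  · simpa using congrFun him' k

section Topology

variable [TopologicalSpace G] [TopologicalSpace M] [IsTopologicalRing M] [ContinuousSMul ℝ M]

theorem continuous_hom (h : IsTorusFrame ι T H) (hι : Topology.IsInducing ι) :
    Continuous h.hom := by
  rw [hι.continuous_iff]
  have : ι ∘ h.hom = circleExp H := funext h.map_hom
  rw [this]
  unfold circleExp
  fun_prop

theorem isTorus [T2Space G] (h : IsTorusFrame ι T H) (hι : Topology.IsInducing ι) : IsTorus T :=
  isTorus_of_injective_hom h.hom (h.continuous_hom hι) h.injective_hom h.range_hom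

end Topology

/-- The element of the torus with `i` in the `k`-th place. -/
theorem map_sub_inv_single (h : IsTorusFrame ι T H) (k : Fin n) :
    ∃ t ∈ T, ι t - ι t⁻¹ = (2 : ℝ) • H k := by
  refine ⟨h.hom (Pi.mulSingle k (Circle.exp (Real.pi / 2))), h.hom_mem _, ?_⟩
  rw [h.map_hom_sub_inv, Finset.sum_eq_single k]
  · simp [Circle.coe_exp]
  · intro j _ hj
    simp [Pi.mulSingle_eq_of_ne hj]
  · simp

/-- A larger torus is commutative, so its elements commute with `t` and `t⁻¹` for each `t ∈ T`,
hence with every `H k`, since `2 H k` has the form `t - t⁻¹`. The centralizer condition then puts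
them in `T`. -/
theorem isMaximalTorus [TopologicalSpace G] [TopologicalSpace M] [IsTopologicalRing M]
    [ContinuousSMul ℝ M] [T2Space G] (h : IsTorusFrame ι T H) (hι : Topology.IsInducing ι) :
    IsMaximalTorus T := by
  refine ⟨h.isTorus hι, fun T' hT' hle g hg => h.centralizer g fun k => ?_⟩
  obtain ⟨t, ht, htk⟩ := h.map_sub_inv_single k
  have h1 := hT'.commute hg (hle ht)
  have h2 := hT'.commute hg (hle (T.inv_mem ht))
  apply smul_right_injective M (two_ne_zero : (2 : ℝ) ≠ 0)
  change (2 : ℝ) • (ι g * H k) = (2 : ℝ) • (H k * ι g)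
  rw [← mul_smul_comm, ← smul_mul_assoc, ← htk, mul_sub, sub_mul, ← map_mul, ← map_mul, ← map_mul,
    ← map_mul, h1, h2]

/-- An element commutes with all `Hᵢ` if and only if it is in the torus. -/
theorem mem_iff_commute (h : IsTorusFrame ι T H) (g : G) :
    g ∈ T ↔ ∀ i, ι g * H i = H i * ι g := by
  refine ⟨fun hg k => ?_, h.centralizer g⟩
  obtain ⟨z, hz⟩ := h.exists_hom_eq hg
  rw [← hz, h.map_hom, circleExp, add_mul, mul_add, one_mul, mul_one, Finset.sum_mul,
    Finset.mul_sum]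
  congr 1
  refine Finset.sum_congr rfl fun i _ => ?_
  by_cases hik : i = k
  · subst hik
    simp [add_mul, mul_add, mul_assoc]
  · have h1 := h.mul_eq_zero i k hik
    have h2 := h.mul_eq_zero k i (Ne.symm hik)
    simp [add_mul, mul_add, mul_assoc, h1, ← mul_assoc (H k), h2]

/-- Reversing `H i` amounts to inverting the circle coordinate, while `H i * H i` does not see the
sign. Conjugation therefore acts on coordinates by permutation and inversion. -/
theorem conj_circleExp (h : IsTorusFrame ι T H) {g : G} {σ : Equiv.Perm (Fin n)} {ε : Fin n → ℤˣ}
    (hg : ∀ i, ι g * H i = ε i • H (σ i) * ι g) (z : Fin n → Circle) :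
    g * h.hom (fun i => z (σ i) ^ (ε i : ℤ)) * g⁻¹ = h.hom z := by
  rw [mul_inv_eq_iff_eq_mul]
  apply h.injective
  rw [map_mul, map_mul, h.map_hom, h.map_hom, circleExp, circleExp, mul_add, add_mul, mul_one,
    one_mul, ← Equiv.sum_comp σ (fun j => (z j : ℂ).im • H j + (1 - (z j : ℂ).re) • (H j * H j)),
    Finset.mul_sum, Finset.sum_mul]
  congr 1
  refine Finset.sum_congr rfl fun i _ => ?_
  have hi := hg i
  rcases Int.units_eq_one_or (ε i) with hε | hε
  · rw [hε, one_smul] at hi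
    have h2 : ι g * (H i * H i) = H (σ i) * H (σ i) * ι g := by
      rw [← mul_assoc, hi, mul_assoc, hi, mul_assoc]
    simp [mul_add, add_mul, hε, hi, h2]
  · rw [hε] at hi
    simp only [Units.neg_smul, one_smul] at hi
    have h2 : ι g * (H i * H i) = H (σ i) * H (σ i) * ι g := by
      rw [← mul_assoc, hi, neg_mul, neg_mul, mul_assoc, hi, neg_mul, mul_neg, neg_neg, mul_assoc]
    simp [mul_add, add_mul, hε, hi, h2]

theorem mem_normalizer_of_signed (h : IsTorusFrame ι T H) {g : G} {σ : Equiv.Perm (Fin n)}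
    {ε : Fin n → ℤˣ} (hg : ∀ i, ι g * H i = ε i • H (σ i) * ι g) :
    g ∈ Subgroup.normalizer (T : Set G) := by
  rw [Subgroup.mem_normalizer_iff]
  intro t
  constructor
  · intro ht
    obtain ⟨z, hz⟩ := h.exists_hom_eq ht
    -- The coordinates are pulled back along the inverse signed permutation. A sign is its own
    -- inverse, so applying it twice restores `z`.
    have hσ : h.hom z =
        h.hom fun i => (fun j => z (σ.symm j) ^ (ε (σ.symm j) : ℤ)) (σ i) ^ (ε i : ℤ) := by
      congr 1
      funext i
      rcases Int.units_eq_one_or (ε i) with hε | hε <;> simp [hε]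
    rw [← hz, hσ, h.conj_circleExp hg fun j => z (σ.symm j) ^ (ε (σ.symm j) : ℤ)]
    exact h.hom_mem _
  · intro ht
    obtain ⟨z, hz⟩ := h.exists_hom_eq ht
    rw [← h.conj_circleExp hg z, mul_left_inj, mul_right_inj] at hz
    rw [← hz]
    exact h.hom_mem _

/-- With `2 H k = t - t⁻¹` for some `t ∈ T`, the conjugate is `t' - t'⁻¹` for another `t' ∈ T`,
which is again a combination of the `H j`. -/
theorem exists_conj_eq_sum (h : IsTorusFrame ι T H) {g : G}
    (hg : g ∈ Subgroup.normalizer (T : Set G)) (k : Fin n) :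
    ∃ s : Fin n → ℝ, ι g * H k * ι g⁻¹ = ∑ j, s j • H j := by
  obtain ⟨t, ht, htk⟩ := h.map_sub_inv_single k
  obtain ⟨z, hz⟩ := h.exists_hom_eq ((Subgroup.mem_normalizer_iff.1 hg t).1 ht)
  refine ⟨fun j => (z j : ℂ).im, ?_⟩
  apply smul_right_injective M (two_ne_zero : (2 : ℝ) ≠ 0)
  change (2 : ℝ) • (ι g * H k * ι g⁻¹) = (2 : ℝ) • _
  rw [← h.map_hom_sub_inv z, hz, ← smul_mul_assoc, ← mul_smul_comm, ← htk]
  simp only [mul_inv_rev, inv_inv, map_mul, mul_sub, sub_mul, mul_assoc]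

/-- Elements of the normalizer of the torus act on the `Hᵢ` by signed permutations. -/
theorem exists_signed_of_mem_normalizer (h : IsTorusFrame ι T H) {g : G}
    (hg : g ∈ Subgroup.normalizer (T : Set G)) :
    ∃ (σ : Equiv.Perm (Fin n)) (ε : Fin n → ℤˣ), ∀ i, ι g * H i = ε i • H (σ i) * ι g := by
  choose s hs using h.exists_conj_eq_sum hg
  have hgg : ι g⁻¹ * ι g = 1 := by rw [← map_mul, inv_mul_cancel, map_one]
  have hconj : ∀ X Y : M, ι g * X * ι g⁻¹ * (ι g * Y * ι g⁻¹) = ι g * (X * Y) * ι g⁻¹ := by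
    intro X Y
    calc _ = ι g * X * (ι g⁻¹ * ι g) * Y * ι g⁻¹ := by simp only [mul_assoc]
      _ = _ := by simp only [hgg, mul_one, mul_assoc]
  -- Conjugation preserves the cubic relation, and cubing a combination of orthogonal generators
  -- cubes its coefficients. So every coefficient is `0`, `1` or `-1`.
  have hcube : ∀ i k, s i k * s i k * s i k = s i k := by
    intro i k
    have h1 : ι g * H i * ι g⁻¹ * (ι g * H i * ι g⁻¹) * (ι g * H i * ι g⁻¹) =
        -(ι g * H i * ι g⁻¹) := by
      rw [hconj, hconj, h.cube, mul_neg, neg_mul]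
    rw [hs, h.sum_mul_sum, Finset.mul_sum, ← Finset.sum_neg_distrib] at h1
    have h2 : ∑ j, (s i j * s i j * s i j) • H j = ∑ j, s i j • H j := by
      rw [← neg_inj, ← Finset.sum_neg_distrib, ← Finset.sum_neg_distrib, ← h1]
      refine Finset.sum_congr rfl fun j _ => ?_
      rw [Finset.sum_mul, Finset.sum_eq_single j]
      · rw [mul_smul_comm, smul_mul_assoc, h.cube, smul_smul, smul_neg, mul_comm]
      · intro l _ hl
        rw [mul_smul_comm, smul_mul_assoc, mul_assoc, h.mul_eq_zero l j hl, mul_zero, smul_zero,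
          smul_zero]
      · simp
    exact congrFun (h.coeff_eq h2) k
  -- Distinct `H i` and `H j` have product zero, hence so do their conjugates. The coefficient at
  -- `k` of that product is `s i k * s j k`.
  have hdisj : ∀ i j k, s i k ≠ 0 → s j k ≠ 0 → i = j := by
    intro i j k hi hj
    by_contra hij
    have h1 := hconj (H i) (H j)
    rw [h.mul_eq_zero i j hij, mul_zero, zero_mul, hs, hs, h.sum_mul_sum] at h1
    have h2 := congrArg (· * H k) h1
    simp only [zero_mul] at h2
    rw [Finset.sum_mul, Finset.sum_eq_single k, smul_mul_assoc, h.cube, smul_eq_zero, neg_eq_zero,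
      or_iff_left (h.ne_zero k)] at h2
    · exact mul_ne_zero hi hj h2
    · intro l _ hl
      rw [smul_mul_assoc, mul_assoc, h.mul_eq_zero l k hl, mul_zero, smul_zero]
    · simp
  have hne : ∀ i, ∃ k, s i k ≠ 0 := by
    intro i
    by_contra! h0
    have h1 := hs i
    simp only [h0, zero_smul, Finset.sum_const_zero] at h1
    apply h.ne_zero i
    calc H i = (ι g⁻¹ * ι g) * H i * (ι g⁻¹ * ι g) := by rw [hgg, one_mul, mul_one]
      _ = ι g⁻¹ * (ι g * H i * ι g⁻¹) * ι g := by simp only [mul_assoc]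
      _ = 0 := by rw [h1, mul_zero, zero_mul]
  choose f hf using hne
  have hfi : Function.Injective f := fun i j hij => hdisj i j (f i) (hf i) (hij ▸ hf j)
  have hfb : Function.Bijective f := Finite.injective_iff_bijective.1 hfi
  have hε : ∀ i, ∃ u : ℤˣ, s i (f i) = ((u : ℤ) : ℝ) := by
    intro i
    have h1 : s i (f i) * s i (f i) = 1 := by
      apply mul_right_cancel₀ (hf i)
      rw [hcube, one_mul]
    rcases mul_self_eq_one_iff.1 h1 with h2 | h2
    · exact ⟨1, by simp [h2]⟩
    · exact ⟨-1, by simp [h2]⟩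
  choose ε hε using hε
  refine ⟨Equiv.ofBijective f hfb, ε, fun i => ?_⟩
  have h1 : ι g * H i * ι g⁻¹ = ε i • H (f i) := by
    rw [hs, Finset.sum_eq_single (f i)]
    · rw [hε]
      rcases Int.units_eq_one_or (ε i) with h2 | h2 <;> simp [h2]
    · intro k _ hk
      -- Every index has the form `f j`, and `s j (f j)` is nonzero. By disjointness `s i (f j)` can
      -- then be nonzero only for `i = j`, so row `i` has the single entry at `f i`.
      obtain ⟨j, rfl⟩ := hfb.2 k
      by_cases h0 : s i (f j) = 0
      · rw [h0, zero_smul]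
      · exact absurd (congrArg f (hdisj i j _ h0 (hf j))) (Ne.symm hk)
    · simp
  rw [Equiv.ofBijective_apply, ← h1, mul_assoc, hgg, mul_one]

end IsTorusFrame

end Frame

/-! ### Signed permutations -/

section SignedPermutations

variable {V : Type*} [AddGroup V] {n : ℕ}

/-- The signed permutation of the pairs `(i, u)` given by a permutation and signs. -/
def signedPerm (x : Equiv.Perm (Fin n) × (Fin n → ℤˣ)) : Equiv.Perm (Fin n × ℤˣ) where
  toFun p := (x.1 p.1, p.2 * x.2 p.1)
  invFun p := (x.1.symm p.1, p.2 * (x.2 (x.1.symm p.1))⁻¹)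
  left_inv p := by simp [mul_assoc]
  right_inv p := by simp [mul_assoc]

theorem signedPerm_injective : Function.Injective (signedPerm (n := n)) := by
  intro x y hxy
  have h : ∀ i, (x.1 i, 1 * x.2 i) = (y.1 i, 1 * y.2 i) := fun i =>
    congrArg (fun π : Equiv.Perm (Fin n × ℤˣ) => π (i, 1)) hxy
  simp only [Prod.mk.injEq, one_mul] at h
  exact Prod.ext (Equiv.ext fun i => (h i).1) (funext fun i => (h i).2)

/-- Compatibility with signs means that `π` is determined by the images of the pairs `(i, 1)`. If
two of these had the same index, then `π (i, 1)` would equal `π (j, 1)` or `π (j, -1)`, so `i = j`.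
-/
theorem exists_signedPerm_eq (π : Equiv.Perm (Fin n × ℤˣ))
    (hπ : ∀ i u, π (i, -u) = ((π (i, u)).1, -(π (i, u)).2)) : ∃ x, signedPerm x = π := by
  have hinj : Function.Injective fun i => (π (i, 1)).1 := by
    intro i j hij
    rcases Int.units_eq_one_or ((π (i, 1)).2 * (π (j, 1)).2) with h | h
    · have h2 : (π (i, 1)).2 = (π (j, 1)).2 := by
        rw [← mul_inv_eq_one, Int.units_inv_eq_self, h]
      exact congrArg Prod.fst (π.injective (Prod.ext hij h2))
    · have h2 : (π (i, 1)).2 = -(π (j, 1)).2 := by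
        rcases Int.units_eq_one_or (π (i, 1)).2 with h1 | h1 <;>
          rcases Int.units_eq_one_or (π (j, 1)).2 with h3 | h3 <;> simp_all
      have h4 : π (i, 1) = π (j, -1) := by
        rw [hπ j 1]
        exact Prod.ext hij h2
      exact congrArg Prod.fst (π.injective h4)
  refine ⟨(Equiv.ofBijective _ (Finite.injective_iff_bijective.1 hinj), fun i => (π (i, 1)).2), ?_⟩
  ext1 ⟨i, u⟩
  rcases Int.units_eq_one_or u with rfl | rfl
  · simp [signedPerm]
  · rw [hπ i 1]
    simp [signedPerm]

/-- The elements `±Hᵢ` are pairwise distinct. -/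
def SignIndependent (H : Fin n → V) : Prop :=
  ∀ (i j : Fin n) (u v : ℤˣ), (u : ℤ) • H i = (v : ℤ) • H j → i = j ∧ u = v

variable {H : Fin n → V}

theorem units_smul_mem_plusMinus (H : Fin n → V) (i : Fin n) (u : ℤˣ) :
    (u : ℤ) • H i ∈ plusMinus H := by
  rcases Int.units_eq_one_or u with rfl | rfl
  · exact ⟨i, Or.inl (by simp)⟩
  · exact ⟨i, Or.inr (by simp)⟩

/-- The elements of `{±H₁, …, ±Hₙ}` correspond to pairs of an index and a sign. -/
noncomputable def SignIndependent.equiv (h : SignIndependent H) : Fin n × ℤˣ ≃ plusMinus H :=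
  Equiv.ofBijective (fun p => ⟨(p.2 : ℤ) • H p.1, units_smul_mem_plusMinus H p.1 p.2⟩) (by
    constructor
    · rintro ⟨i, u⟩ ⟨j, v⟩ hij
      obtain ⟨h1, h2⟩ := h i j u v (congrArg Subtype.val hij)
      exact Prod.ext h1 h2
    · rintro ⟨X, i, rfl | rfl⟩
      · exact ⟨(i, 1), by simp⟩
      · exact ⟨(i, -1), by simp⟩)

theorem SignIndependent.coe_equiv (h : SignIndependent H) (i : Fin n) (u : ℤˣ) :
    (h.equiv (i, u) : V) = (u : ℤ) • H i := rfl

/-- The signed permutation of `{±H₁, …, ±Hₙ}` given by a permutation and signs. -/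
noncomputable def SignIndependent.perm (h : SignIndependent H)
    (x : Equiv.Perm (Fin n) × (Fin n → ℤˣ)) : Equiv.Perm (plusMinus H) :=
  h.equiv.permCongr (signedPerm x)

theorem SignIndependent.perm_equiv (h : SignIndependent H)
    (x : Equiv.Perm (Fin n) × (Fin n → ℤˣ)) (p : Fin n × ℤˣ) :
    h.perm x (h.equiv p) = h.equiv (x.1 p.1, p.2 * x.2 p.1) := by
  simp [SignIndependent.perm, Equiv.permCongr_apply, signedPerm]

theorem SignIndependent.perm_injective (h : SignIndependent H) : Function.Injective h.perm :=
  h.equiv.permCongr.injective.comp signedPerm_injective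

theorem SignIndependent.equiv_neg (h : SignIndependent H) (p : Fin n × ℤˣ) :
    (h.equiv (p.1, -p.2) : V) = -(h.equiv p : V) := by
  rw [h.coe_equiv, ← Prod.mk.eta (p := p), h.coe_equiv]
  simp

theorem SignIndependent.range_perm (h : SignIndependent H) :
    Set.range h.perm = signedPerms H := by
  apply Set.Subset.antisymm
  · rintro _ ⟨x, rfl⟩ X Y hXY
    obtain ⟨p, rfl⟩ := h.equiv.surjective X
    rw [← h.equiv_neg] at hXY
    rw [Subtype.ext hXY, h.perm_equiv, h.perm_equiv, ← h.equiv_neg]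
    simp
  · intro π hπ
    obtain ⟨x, hx⟩ := exists_signedPerm_eq (h.equiv.permCongr.symm π) (by
      intro i u
      simp only [Equiv.permCongr_symm, Equiv.permCongr_apply, Equiv.symm_symm]
      rw [Equiv.symm_apply_eq]
      apply Subtype.ext
      rw [hπ (h.equiv (i, u)) (h.equiv (i, -u)) (h.equiv_neg (i, u)), h.equiv_neg,
        Equiv.apply_symm_apply])
    exact ⟨x, by rw [SignIndependent.perm, hx, Equiv.apply_symm_apply]⟩

theorem SignIndependent.card_signedPerms (h : SignIndependent H) :
    Nat.card (signedPerms H) = 2 ^ n * n ! := by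
  rw [← h.range_perm, Nat.card_congr (Equiv.ofInjective _ h.perm_injective).symm, Nat.card_prod,
    Nat.card_perm, Nat.card_fun]
  simp [mul_comm]

theorem SignIndependent.negativeIndices_perm (h : SignIndependent H)
    (x : Equiv.Perm (Fin n) × (Fin n → ℤˣ)) :
    negativeIndices H (h.perm x) = {i | x.2 i = -1} := by
  ext i
  have h1 : (⟨H i, i, Or.inl rfl⟩ : plusMinus H) = h.equiv (i, 1) :=
    Subtype.ext (by rw [h.coe_equiv]; simp)
  simp only [negativeIndices, Set.mem_ofPred_eq]
  rw [h1, h.perm_equiv, h.coe_equiv, one_mul]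
  constructor
  · rintro ⟨j, hj⟩
    exact (h (x.1 i) j (x.2 i) (-1) (by rw [hj]; simp)).2
  · intro hi
    exact ⟨x.1 i, by rw [hi]; simp⟩

/-- Links the parity in `evenSignedPerms` with the product of signs, which is the form in which
determinants enter. -/
theorem prod_units_eq_one_iff (ε : Fin n → ℤˣ) :
    ∏ i, ε i = 1 ↔ Even {i | ε i = -1}.ncard := by
  have h : ∏ i, ε i = (-1) ^ {i | ε i = -1}.ncard := by
    rw [Set.ncard_eq_toFinset_card', ← Finset.prod_const]
    rw [← Finset.prod_subset (Finset.subset_univ {i | ε i = -1}.toFinset)]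
    · exact Finset.prod_congr rfl fun i hi => by simpa using hi
    · intro i _ hi
      exact (Int.units_eq_one_or (ε i)).resolve_right (by simpa using hi)
  rw [h]
  exact neg_one_pow_eq_one_iff_even (by decide)

theorem SignIndependent.image_perm (h : SignIndependent H) :
    h.perm '' {x | ∏ i, x.2 i = 1} = evenSignedPerms H := by
  ext π
  simp only [evenSignedPerms, ← h.range_perm, Set.mem_ofPred_eq, Set.mem_image]
  constructor
  · rintro ⟨x, hx, rfl⟩
    exact ⟨⟨x, rfl⟩, by rwa [h.negativeIndices_perm, ← prod_units_eq_one_iff]⟩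
  · rintro ⟨⟨x, rfl⟩, hx⟩
    exact ⟨x, by rwa [h.negativeIndices_perm, ← prod_units_eq_one_iff] at hx, rfl⟩

/-- The first sign is forced to be the product of the others, since signs are their own inverses.
The remaining `n - 1` signs and the permutation are free. -/
theorem SignIndependent.card_evenSignedPerms (h : SignIndependent H) (hn : 0 < n) :
    Nat.card (evenSignedPerms H) = 2 ^ (n - 1) * n ! := by
  obtain ⟨m, rfl⟩ : ∃ m, n = m + 1 := ⟨n - 1, by omega⟩
  have e : {x : Equiv.Perm (Fin (m + 1)) × (Fin (m + 1) → ℤˣ) | ∏ i, x.2 i = 1} ≃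
      Equiv.Perm (Fin (m + 1)) × (Fin m → ℤˣ) :=
    { toFun := fun x => (x.1.1, Fin.tail x.1.2)
      invFun := fun y => ⟨(y.1, Fin.cons (∏ i, y.2 i) y.2), by
        simp [Fin.prod_univ_succ, Int.units_mul_self]⟩
      left_inv := by
        rintro ⟨⟨σ, ε⟩, hε⟩
        have h0 : ε 0 * ∏ i : Fin m, ε i.succ = 1 := by
          rw [← Fin.prod_univ_succ]
          exact hε
        have h1 : ε 0 = ∏ i : Fin m, ε i.succ := by
          rw [← mul_inv_eq_one, Int.units_inv_eq_self, h0]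
        apply Subtype.ext
        refine Prod.ext rfl ?_
        change Fin.cons (∏ i, Fin.tail ε i) (Fin.tail ε) = ε
        conv_rhs => rw [← Fin.cons_self_tail ε, h1]
        rfl
      right_inv := fun y => by simp }
  rw [← h.image_perm, Nat.card_image_of_injective h.perm_injective, Nat.card_congr e,
    Nat.card_prod, Nat.card_perm, Nat.card_fun]
  simp [mul_comm]

end SignedPermutations

/-! ### The action of the Weyl group -/

section Action

variable {G M : Type*} [Group G] [Ring M] [Algebra ℝ M] {n : ℕ} {ι : G →* M} {T : Subgroup G}
  {H : Fin n → M}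

namespace IsTorusFrame

theorem signIndependent (h : IsTorusFrame ι T H) : SignIndependent H := fun _ _ _ _ huv =>
  h.eq_iff_of_sign huv

theorem conj_mem_plusMinus (h : IsTorusFrame ι T H) {g : G}
    (hg : g ∈ Subgroup.normalizer (T : Set G)) {X : M} (hX : X ∈ plusMinus H) :
    ι g * X * ι g⁻¹ ∈ plusMinus H := by
  obtain ⟨σ, ε, hσ⟩ := h.exists_signed_of_mem_normalizer hg
  have hgg : ι g * ι g⁻¹ = 1 := by rw [← map_mul, mul_inv_cancel, map_one]
  have key : ∀ i, ι g * H i * ι g⁻¹ = ε i • H (σ i) := fun i => by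
    rw [hσ, mul_assoc, hgg, mul_one]
  rcases hX with ⟨i, rfl | rfl⟩
  · rw [key]
    exact units_smul_mem_plusMinus H _ _
  · rw [mul_neg, neg_mul, key, ← Units.neg_smul]
    exact units_smul_mem_plusMinus H _ _

/-- The action of the normalizer of the torus by conjugation. -/
def conjHom (h : IsTorusFrame ι T H) :
    Subgroup.normalizer (T : Set G) →* Equiv.Perm (plusMinus H) where
  toFun g :=
    { toFun := fun X => ⟨ι g * X * ι (g : G)⁻¹, h.conj_mem_plusMinus g.2 X.2⟩
      invFun := fun X => ⟨ι (g : G)⁻¹ * X * ι (g : G)⁻¹⁻¹, h.conj_mem_plusMinus (g⁻¹).2 X.2⟩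
      left_inv := fun X => Subtype.ext (by
        simp only [inv_inv, ← mul_assoc, ← map_mul, inv_mul_cancel, map_one, one_mul]
        rw [mul_assoc, ← map_mul, inv_mul_cancel, map_one, mul_one])
      right_inv := fun X => Subtype.ext (by
        simp only [inv_inv, ← mul_assoc, ← map_mul, mul_inv_cancel, map_one, one_mul]
        rw [mul_assoc, ← map_mul, mul_inv_cancel, map_one, mul_one]) }
  map_one' := by
    ext X
    simp
  map_mul' g g' := by
    ext X
    simp [mul_assoc]

theorem coe_conjHom (h : IsTorusFrame ι T H) (g : Subgroup.normalizer (T : Set G))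
    (X : plusMinus H) : (h.conjHom g X : M) = ι g * X * ι (g : G)⁻¹ := rfl

/-- Acting trivially on the `±H i` means commuting with every `H i`, which characterizes `T`. This
is the faithfulness of the Weyl group action. -/
theorem ker_conjHom (h : IsTorusFrame ι T H) :
    h.conjHom.ker = T.subgroupOf (Subgroup.normalizer (T : Set G)) := by
  ext g
  have hgg : ι (g : G)⁻¹ * ι (g : G) = 1 := by rw [← map_mul, inv_mul_cancel, map_one]
  have hgg' : ι (g : G) * ι (g : G)⁻¹ = 1 := by rw [← map_mul, mul_inv_cancel, map_one]
  rw [MonoidHom.mem_ker, Subgroup.mem_subgroupOf, h.mem_iff_commute]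
  constructor
  · intro hg i
    have h1 := h.coe_conjHom g ⟨H i, i, Or.inl rfl⟩
    rw [hg, Equiv.Perm.one_apply] at h1
    change H i = ι g * H i * ι (g : G)⁻¹ at h1
    conv_rhs => rw [h1]
    rw [mul_assoc, hgg, mul_one]
  · intro hg
    ext X
    rw [h.coe_conjHom, Equiv.Perm.one_apply]
    obtain ⟨X, i, rfl | rfl⟩ := X
    · rw [hg, mul_assoc, hgg', mul_one]
    · rw [mul_neg, hg, neg_mul, mul_assoc, hgg', mul_one]

theorem conjHom_eq_perm_iff (h : IsTorusFrame ι T H) (g : Subgroup.normalizer (T : Set G))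
    (σ : Equiv.Perm (Fin n)) (ε : Fin n → ℤˣ) :
    h.conjHom g = h.signIndependent.perm (σ, ε) ↔ ∀ i, ι g * H i = ε i • H (σ i) * ι g := by
  have hgg : ι (g : G)⁻¹ * ι (g : G) = 1 := by rw [← map_mul, inv_mul_cancel, map_one]
  have hgg' : ι (g : G) * ι (g : G)⁻¹ = 1 := by rw [← map_mul, mul_inv_cancel, map_one]
  have key : ∀ i u, h.conjHom g (h.signIndependent.equiv (i, u)) =
      h.signIndependent.perm (σ, ε) (h.signIndependent.equiv (i, u)) ↔
        ι g * H i = ε i • H (σ i) * ι g := by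
    intro i u
    rw [h.signIndependent.perm_equiv, ← Subtype.coe_inj, h.coe_conjHom,
      h.signIndependent.coe_equiv, h.signIndependent.coe_equiv]
    have h1 : ∀ X Y : M, ι g * X * ι (g : G)⁻¹ = Y ↔ ι g * X = Y * ι g := fun X Y =>
      ⟨fun hX => by rw [← hX, mul_assoc, hgg, mul_one],
        fun hX => by rw [hX, mul_assoc, hgg', mul_one]⟩
    rw [h1]
    rcases Int.units_eq_one_or u with rfl | rfl <;>
      rcases Int.units_eq_one_or (ε i) with hε | hε <;> simp [hε, neg_eq_iff_eq_neg]
  constructor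
  · intro hg i
    rw [← key i 1, hg]
  · intro hg
    ext1 X
    obtain ⟨⟨i, u⟩, rfl⟩ := h.signIndependent.equiv.surjective X
    exact (key i u).2 (hg i)

/-- The Weyl group acts as the signed permutations which are realized by elements of the group. -/
theorem weylGroupActsAs (h : IsTorusFrame ι T H) (Q : Set (Equiv.Perm (Fin n) × (Fin n → ℤˣ)))
    (hQ : ∀ x, x ∈ Q ↔ ∃ g, ∀ i, ι g * H i = x.2 i • H (x.1 i) * ι g) :
    WeylGroupActsAs ι T H (h.signIndependent.perm '' Q) := by
  refine ⟨QuotientGroup.lift _ h.conjHom h.ker_conjHom.ge, fun g X => rfl, ?_, ?_⟩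
  · rw [injective_iff_map_eq_one]
    intro w
    induction w using QuotientGroup.induction_on with
    | H g =>
      intro hg
      rw [QuotientGroup.eq_one_iff, ← h.ker_conjHom]
      exact hg
  · ext π
    constructor
    · rintro ⟨w, rfl⟩
      induction w using QuotientGroup.induction_on with
      | H g =>
        obtain ⟨σ, ε, hσ⟩ := h.exists_signed_of_mem_normalizer g.2
        exact ⟨(σ, ε), (hQ _).2 ⟨g, hσ⟩, ((h.conjHom_eq_perm_iff g σ ε).2 hσ).symm⟩
    · rintro ⟨⟨σ, ε⟩, hx, rfl⟩
      obtain ⟨g, hg⟩ := (hQ _).1 hx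
      exact ⟨QuotientGroup.mk ⟨g, h.mem_normalizer_of_signed hg⟩,
        (h.conjHom_eq_perm_iff ⟨g, _⟩ σ ε).2 hg⟩

end IsTorusFrame

end Action

theorem WeylGroupActsAs.card_eq {G M : Type*} [Group G] [Ring M] {n : ℕ} {ι : G →* M}
    {T : Subgroup G} {H : Fin n → M} {P : Set (Equiv.Perm (plusMinus H))}
    (h : WeylGroupActsAs ι T H P) : Nat.card (WeylGroup T) = Nat.card P := by
  obtain ⟨ρ, -, hρ, rfl⟩ := h
  exact Nat.card_congr (Equiv.ofInjective _ hρ)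

/-! ### Invariant subspaces of commuting isometries -/

section Invariant

open scoped InnerProductSpace

variable {E : Type*} [NormedAddCommGroup E] [InnerProductSpace ℝ E]

/-- Commuting symmetric operators have a common eigenvector in each invariant subspace. -/
theorem exists_common_eigenvector [FiniteDimensional ℝ E] {ι : Type*} {A : ι → Module.End ℝ E}
    (hA : ∀ i, (A i).IsSymmetric) (hcomm : ∀ i j, Commute (A i) (A j)) {F : Submodule ℝ E}
    (hF : ∀ i, ∀ x ∈ F, A i x ∈ F) (hne : F ≠ ⊥) :
    ∃ v ∈ F, ‖v‖ = 1 ∧ ∀ i, ∃ c : ℝ, A i v = c • v := by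
  let B : ι → Module.End ℝ F := fun i => (A i).restrict (hF i)
  have hB : ∀ i, (B i).IsSymmetric := fun i => (hA i).restrict_invariant (hF i)
  have htop := LinearMap.IsSymmetric.iSup_iInf_eq_top_of_commute hB fun i j _ => by
    refine LinearMap.ext fun x => Subtype.ext ?_
    exact LinearMap.congr_fun (hcomm i j) (x : E)
  have hnt : Nontrivial F := Submodule.nontrivial_iff_ne_bot.2 hne
  obtain ⟨χ, hχ⟩ : ∃ χ : ι → ℝ, ⨅ i, Module.End.eigenspace (B i) (χ i) ≠ ⊥ := by
    by_contra! h
    simp only [h, iSup_bot] at htop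
    exact bot_ne_top htop
  obtain ⟨x, hx, hx0⟩ := Submodule.exists_mem_ne_zero_of_ne_bot hχ
  have hx0' : (x : E) ≠ 0 := fun h => hx0 (Subtype.ext h)
  refine ⟨‖(x : E)‖⁻¹ • (x : E), F.smul_mem _ x.2, norm_smul_inv_norm hx0', fun i => ⟨χ i, ?_⟩⟩
  have h1 := Module.End.mem_eigenspace_iff.1 ((Submodule.mem_iInf _).1 hx i)
  have h2 : A i (x : E) = χ i • (x : E) := congrArg Subtype.val h1
  rw [map_smul, h2, smul_comm]

variable {G : Type*} [Group G] (ρ : G →* Module.End ℝ E) (T : Subgroup G)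

/-- The elements of `T` act on the span of `v` and `w` by rotations. -/
def IsRotationPair (v w : E) : Prop :=
  ∀ t ∈ T, ∃ z : Circle, ρ t v = (z : ℂ).re • v - (z : ℂ).im • w ∧
    ρ t w = (z : ℂ).im • v + (z : ℂ).re • w

variable {ρ T}

theorem inner_self_map_eq (hρ : ∀ g x y, ⟪ρ g x, y⟫_ℝ = ⟪x, ρ g⁻¹ y⟫_ℝ) (g : G) (x y : E) :
    ⟪ρ g x, ρ g y⟫_ℝ = ⟪x, y⟫_ℝ := by
  rw [hρ, ← Module.End.mul_apply, ← map_mul, inv_mul_cancel, map_one, Module.End.one_apply]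

theorem map_sub_inv_skew (hρ : ∀ g x y, ⟪ρ g x, y⟫_ℝ = ⟪x, ρ g⁻¹ y⟫_ℝ) (g : G) (x y : E) :
    ⟪(ρ g - ρ g⁻¹) x, y⟫_ℝ = -⟪x, (ρ g - ρ g⁻¹) y⟫_ℝ := by
  simp only [LinearMap.sub_apply, inner_sub_left, inner_sub_right, hρ, inv_inv]
  ring

theorem map_add_inv_isSymmetric (hρ : ∀ g x y, ⟪ρ g x, y⟫_ℝ = ⟪x, ρ g⁻¹ y⟫_ℝ) (g : G) :
    (ρ g + ρ g⁻¹).IsSymmetric := by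
  intro x y
  simp only [LinearMap.add_apply, inner_add_left, inner_add_right, hρ, inv_inv]
  ring

theorem circle_of_sq_add_sq {a b : ℝ} (h : a * a + b * b = 1) :
    ∃ z : Circle, (z : ℂ).re = a ∧ (z : ℂ).im = b := by
  refine ⟨⟨⟨a, b⟩, ?_⟩, rfl, rfl⟩
  rw [Submonoid.unitSphere, ← SetLike.mem_coe]
  simp [Complex.norm_eq_sqrt_sq_add_sq, pow_two, h]

/-- A commuting family of isometries all of which are squares has a common fixed vector or a common
invariant plane on which it acts by rotations. -/
theorem exists_fixed_or_rotationPair [FiniteDimensional ℝ E]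
    (hρ : ∀ g x y, ⟪ρ g x, y⟫_ℝ = ⟪x, ρ g⁻¹ y⟫_ℝ)
    (hcomm : ∀ s ∈ T, ∀ t ∈ T, s * t = t * s) (hsq : ∀ t ∈ T, ∃ s ∈ T, s * s = t)
    {F : Submodule ℝ E} (hF : ∀ t ∈ T, ∀ x ∈ F, ρ t x ∈ F) (hne : F ≠ ⊥) :
    ∃ v ∈ F, ‖v‖ = 1 ∧ ((∀ t ∈ T, ρ t v = v) ∨
      ∃ w ∈ F, ‖w‖ = 1 ∧ ⟪v, w⟫_ℝ = 0 ∧ IsRotationPair ρ T v w) := by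
  have hc : ∀ s ∈ T, ∀ t ∈ T, Commute (ρ s) (ρ t) := fun s hs t ht => by
    rw [commute_iff_eq, ← map_mul, ← map_mul, hcomm s hs t ht]
  have hcD : ∀ s ∈ T, ∀ t ∈ T, Commute (ρ s) (ρ t - ρ t⁻¹) := fun s hs t ht =>
    (hc s hs t ht).sub_right (hc s hs _ (T.inv_mem ht))
  have hcDD : ∀ s ∈ T, ∀ t ∈ T, Commute (ρ s - ρ s⁻¹) (ρ t - ρ t⁻¹) := fun s hs t ht =>
    (hcD s hs t ht).sub_left (hcD _ (T.inv_mem hs) t ht)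
  have hcAD : ∀ s ∈ T, ∀ t ∈ T, Commute (ρ s + ρ s⁻¹) (ρ t - ρ t⁻¹) := fun s hs t ht =>
    (hcD s hs t ht).add_left (hcD _ (T.inv_mem hs) t ht)
  have hcAA : ∀ s ∈ T, ∀ t ∈ T, Commute (ρ s + ρ s⁻¹) (ρ t + ρ t⁻¹) := fun s hs t ht =>
    ((hc s hs t ht).add_right (hc s hs _ (T.inv_mem ht))).add_left
      ((hc _ (T.inv_mem hs) t ht).add_right (hc _ (T.inv_mem hs) _ (T.inv_mem ht)))
  have hFD : ∀ t ∈ T, ∀ x ∈ F, (ρ t - ρ t⁻¹) x ∈ F := fun t ht x hx =>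
    F.sub_mem (hF t ht x hx) (hF _ (T.inv_mem ht) x hx)
  -- The operators `ρ t - ρ t⁻¹` are skew, but products of two commuting skew operators are
  -- symmetric. Hence sums and such products have a common eigenvector.
  let A : T ⊕ T × T → Module.End ℝ E := Sum.elim (fun t => ρ t + ρ (t : G)⁻¹)
    fun p => (ρ p.1 - ρ (p.1 : G)⁻¹) * (ρ p.2 - ρ (p.2 : G)⁻¹)
  obtain ⟨v, hvF, hv1, hv⟩ := exists_common_eigenvector (A := A) (F := F) (by
    rintro (t | ⟨s, t⟩)
    · exact map_add_inv_isSymmetric hρ _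
    · intro x y
      change ⟪(ρ s - ρ (s : G)⁻¹) ((ρ t - ρ (t : G)⁻¹) x), y⟫_ℝ =
        ⟪x, ((ρ s - ρ (s : G)⁻¹) * (ρ t - ρ (t : G)⁻¹)) y⟫_ℝ
      rw [map_sub_inv_skew hρ, map_sub_inv_skew hρ, neg_neg, (hcDD s s.2 t t.2).eq]
      rfl) (by
    rintro (t | ⟨s, t⟩) (t' | ⟨s', t'⟩)
    · exact hcAA t t.2 t' t'.2
    · exact (hcAD t t.2 s' s'.2).mul_right (hcAD t t.2 t' t'.2)
    · exact (hcAD t' t'.2 s s.2).symm.mul_left (hcAD t' t'.2 t t.2).symm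
    · exact ((hcDD s s.2 s' s'.2).mul_right (hcDD s s.2 t' t'.2)).mul_left
        ((hcDD t t.2 s' s'.2).mul_right (hcDD t t.2 t' t'.2))) (by
    rintro (t | ⟨s, t⟩) x hx
    · exact F.add_mem (hF t t.2 x hx) (hF _ (T.inv_mem t.2) x hx)
    · exact hFD s s.2 _ (hFD t t.2 x hx)) hne
  refine ⟨v, hvF, hv1, ?_⟩
  by_cases hD : ∀ t ∈ T, (ρ t - ρ t⁻¹) v = 0
  · refine Or.inl fun t ht => ?_
    -- If `s` and `s⁻¹` agree on `v`, then `s * s` fixes `v`. Without square roots only `t v = ±v`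
    -- would follow.
    obtain ⟨s, hs, rfl⟩ := hsq t ht
    have h1 := sub_eq_zero.1 ((LinearMap.sub_apply _ _ _).symm.trans (hD s hs))
    rw [map_mul, Module.End.mul_apply, h1, ← Module.End.mul_apply, ← map_mul, mul_inv_cancel,
      map_one, Module.End.one_apply]
  · right
    push Not at hD
    obtain ⟨t, ht, hDt⟩ := hD
    set D := ρ t - ρ t⁻¹ with hDdef
    set r := ‖D v‖ with hr
    have hr0 : r ≠ 0 := norm_ne_zero_iff.2 hDt
    have hvv : ⟪v, v⟫_ℝ = 1 := by rw [real_inner_self_eq_norm_sq, hv1, one_pow]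
    obtain ⟨c, hcv⟩ := hv (Sum.inr (⟨t, ht⟩, ⟨t, ht⟩))
    change D (D v) = c • v at hcv
    -- By skewness the inner product of `D (D v)` with `v` is minus the squared norm of `D v`.
    have hc0 : c ≠ 0 := by
      rintro rfl
      have h1 := map_sub_inv_skew hρ t (D v) v
      rw [← hDdef, hcv, zero_smul, inner_zero_left, zero_eq_neg] at h1
      exact hDt (inner_self_eq_zero.1 h1)
    set w := r⁻¹ • D v with hw
    have hDv : D v = r • w := by rw [hw, smul_smul, mul_inv_cancel₀ hr0, one_smul]
    have hvw : ⟪v, w⟫_ℝ = 0 := by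
      have h1 := map_sub_inv_skew hρ t v v
      rw [← hDdef, real_inner_comm, hDv, inner_smul_right] at h1
      have h2 : r * ⟪v, w⟫_ℝ = 0 := by linarith
      exact (mul_eq_zero.1 h2).resolve_left hr0
    have hw1 : ‖w‖ = 1 := norm_smul_inv_norm hDt
    have hww : ⟪w, w⟫_ℝ = 1 := by rw [real_inner_self_eq_norm_sq, hw1, one_pow]
    have hwF : w ∈ F := F.smul_mem _ (hFD t ht v hvF)
    clear_value w
    refine ⟨w, hwF, hw1, hvw, fun s hs => ?_⟩
    obtain ⟨a, ha⟩ := hv (Sum.inl ⟨s, hs⟩)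
    obtain ⟨d, hd⟩ := hv (Sum.inr (⟨s, hs⟩, ⟨t, ht⟩))
    change (ρ s + ρ s⁻¹) v = a • v at ha
    change (ρ s - ρ s⁻¹) (D v) = d • v at hd
    have hDw : (ρ s - ρ s⁻¹) w = (r⁻¹ * d) • v := by rw [hw, map_smul, hd, smul_smul]
    have hAw : (ρ s + ρ s⁻¹) w = a • w := by
      have h1 := LinearMap.congr_fun (hcAD s hs t ht).eq v
      rw [Module.End.mul_apply, Module.End.mul_apply, ← hDdef, ha, map_smul] at h1
      rw [hw, map_smul, h1, smul_comm]
    -- The eigenvalue `c` of `D * D` on `v` is nonzero, so `v` is a multiple of `D (D v)`. Moving `ρ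
    -- s - ρ s⁻¹` past one `D` then lands in the line of `D v`, that is, of `w`.
    have hDsv : ∃ b : ℝ, (ρ s - ρ s⁻¹) v = b • w := by
      have h1 := LinearMap.congr_fun (hcDD s hs t ht).eq (D v)
      rw [Module.End.mul_apply, Module.End.mul_apply, ← hDdef, hcv, hd, map_smul, map_smul, hDv,
        smul_smul] at h1
      exact ⟨c⁻¹ * (d * r), by rw [mul_smul, ← h1, smul_smul, inv_mul_cancel₀ hc0, one_smul]⟩
    obtain ⟨b, hb⟩ := hDsv
    have hbd : r⁻¹ * d = -b := by
      have h1 := map_sub_inv_skew hρ s v w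
      rw [hb, hDw, inner_smul_left, inner_smul_right, hww, hvv] at h1
      simp only [conj_trivial] at h1
      linarith
    have half : ∀ x : E, ρ s x = (2⁻¹ : ℝ) • ((ρ s + ρ s⁻¹) x + (ρ s - ρ s⁻¹) x) := by
      intro x
      rw [LinearMap.add_apply, LinearMap.sub_apply]
      module
    have hsv : ρ s v = (2⁻¹ * a) • v - (-(2⁻¹ * b)) • w := by rw [half, ha, hb]; module
    have hsw : ρ s w = (-(2⁻¹ * b)) • v + (2⁻¹ * a) • w := by rw [half, hAw, hDw, hbd]; module
    -- The coefficients lie on the circle because `ρ s` preserves the norm of `v`.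
    obtain ⟨z, hz1, hz2⟩ := circle_of_sq_add_sq (a := 2⁻¹ * a) (b := -(2⁻¹ * b)) (by
      have h1 := inner_self_map_eq hρ s v v
      rw [hsv, inner_sub_sub_self, hvv] at h1
      simp only [inner_smul_left, inner_smul_right, hvv, hww, hvw, real_inner_comm v w,
        conj_trivial] at h1
      linarith)
    exact ⟨z, by rw [hz1, hz2, hsv], by rw [hz1, hz2, hsw]⟩

/-- The adjoint of `ρ t` is `ρ t⁻¹`, and `T` contains `t⁻¹`, so the span is also stable under the
adjoint. -/
theorem orthogonal_invariant (hρ : ∀ g x y, ⟪ρ g x, y⟫_ℝ = ⟪x, ρ g⁻¹ y⟫_ℝ) {ι : Type*} {u : ι → E}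
    (hu : ∀ t ∈ T, ∀ i, ρ t (u i) ∈ Submodule.span ℝ (Set.range u)) {t : G} (ht : t ∈ T) {x : E}
    (hx : x ∈ (Submodule.span ℝ (Set.range u))ᗮ) : ρ t x ∈ (Submodule.span ℝ (Set.range u))ᗮ := by
  rw [Submodule.mem_orthogonal'] at hx ⊢
  intro y hy
  rw [hρ]
  apply hx
  have h1 : Submodule.span ℝ (Set.range u) ≤
      (Submodule.span ℝ (Set.range u)).comap (ρ t⁻¹) := by
    rw [Submodule.span_le]
    rintro _ ⟨i, rfl⟩
    exact hu _ (T.inv_mem ht) i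
  exact h1 hy

/-- In an invariant subspace of dimension at least two there is a common invariant plane on which
the isometries act by rotations. -/
theorem exists_rotationPair [FiniteDimensional ℝ E] (hρ : ∀ g x y, ⟪ρ g x, y⟫_ℝ = ⟪x, ρ g⁻¹ y⟫_ℝ)
    (hcomm : ∀ s ∈ T, ∀ t ∈ T, s * t = t * s) (hsq : ∀ t ∈ T, ∃ s ∈ T, s * s = t)
    {F : Submodule ℝ E} (hF : ∀ t ∈ T, ∀ x ∈ F, ρ t x ∈ F) (h2 : 2 ≤ Module.finrank ℝ F) :
    ∃ v ∈ F, ∃ w ∈ F, ‖v‖ = 1 ∧ ‖w‖ = 1 ∧ ⟪v, w⟫_ℝ = 0 ∧ IsRotationPair ρ T v w := by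
  have hne : F ≠ ⊥ := by
    rintro rfl
    simp at h2
  obtain ⟨v, hvF, hv1, hv | ⟨w, hw, hw1, hvw, hrot⟩⟩ :=
    exists_fixed_or_rotationPair hρ hcomm hsq hF hne
  swap
  · exact ⟨v, hvF, w, hw, hv1, hw1, hvw, hrot⟩
  -- When `v` is fixed, its orthogonal complement has codimension at most one and so meets `F`
  -- nontrivially. A second fixed vector there forms with `v` a plane of trivial rotations.
  have hne' : F ⊓ (Submodule.span ℝ (Set.range fun _ : Unit => v))ᗮ ≠ ⊥ := by
    intro h0
    have h1 := Submodule.finrank_add_finrank_le_of_disjoint (disjoint_iff.2 h0)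
    have h3 := Submodule.finrank_add_finrank_orthogonal
      (Submodule.span ℝ (Set.range fun _ : Unit => v))
    have h4 : Module.finrank ℝ (Submodule.span ℝ (Set.range fun _ : Unit => v)) ≤ 1 :=
      finrank_range_le_card _
    omega
  obtain ⟨v', hv'F, hv'1, hv' | ⟨w, hw, hw1, hvw, hrot⟩⟩ :=
    exists_fixed_or_rotationPair hρ hcomm hsq
      (F := F ⊓ (Submodule.span ℝ (Set.range fun _ : Unit => v))ᗮ) (fun t ht x hx =>
        ⟨hF t ht x hx.1, orthogonal_invariant hρ (T := T) (fun s hs i => by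
          rw [hv s hs]; exact Submodule.subset_span ⟨i, rfl⟩) ht hx.2⟩) hne'
  · refine ⟨v, hvF, v', hv'F.1, hv1, hv'1, ?_, fun t ht => ⟨1, ?_, ?_⟩⟩
    · exact (Submodule.mem_orthogonal _ _).1 hv'F.2 v (Submodule.subset_span ⟨(), rfl⟩)
    · simp [hv t ht]
    · simp [hv' t ht]
  · exact ⟨v', hv'F.1, w, hw.1, hv'1, hw1, hvw, hrot⟩

theorem map_mem_span_of_rotationPairs {k : ℕ} {u : Fin 2 × Fin k → E}
    (hrot : ∀ i, IsRotationPair ρ T (u (0, i)) (u (1, i))) :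
    ∀ t ∈ T, ∀ i, ρ t (u i) ∈ Submodule.span ℝ (Set.range u) := by
  rintro t ht ⟨a, i⟩
  obtain ⟨z, hz0, hz1⟩ := hrot i t ht
  have h0 : u (0, i) ∈ Submodule.span ℝ (Set.range u) := Submodule.subset_span ⟨_, rfl⟩
  have h1 : u (1, i) ∈ Submodule.span ℝ (Set.range u) := Submodule.subset_span ⟨_, rfl⟩
  fin_cases a
  · exact hz0 ▸ Submodule.sub_mem _ (Submodule.smul_mem _ _ h0) (Submodule.smul_mem _ _ h1)
  · exact hz1 ▸ Submodule.add_mem _ (Submodule.smul_mem _ _ h0) (Submodule.smul_mem _ _ h1)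

/-- Orthonormal pairs of vectors spanning planes on which commuting isometries act by rotations. -/
theorem exists_orthonormal_rotationPairs [FiniteDimensional ℝ E]
    (hρ : ∀ g x y, ⟪ρ g x, y⟫_ℝ = ⟪x, ρ g⁻¹ y⟫_ℝ)
    (hcomm : ∀ s ∈ T, ∀ t ∈ T, s * t = t * s) (hsq : ∀ t ∈ T, ∃ s ∈ T, s * s = t) (k : ℕ)
    (hk : 2 * k ≤ Module.finrank ℝ E) :
    ∃ u : Fin 2 × Fin k → E, Orthonormal ℝ u ∧ ∀ i, IsRotationPair ρ T (u (0, i)) (u (1, i)) := by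
  induction k with
  | zero => exact ⟨fun _ => 0, ⟨fun i => i.2.elim0, fun i => i.2.elim0⟩, fun i => i.elim0⟩
  | succ k ih =>
    obtain ⟨u, hu, hrot⟩ := ih (by omega)
    have hspan := map_mem_span_of_rotationPairs hrot
    obtain ⟨v, hv, w, hw, hv1, hw1, hvw, hr⟩ := exists_rotationPair hρ hcomm hsq
      (F := (Submodule.span ℝ (Set.range u))ᗮ)
      (fun t ht x hx => orthogonal_invariant hρ hspan ht hx) (by
        have h1 := Submodule.finrank_add_finrank_orthogonal (Submodule.span ℝ (Set.range u))
        rw [finrank_span_eq_card hu.linearIndependent] at h1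
        simp at h1
        omega)
    have hvu : ∀ p, ⟪v, u p⟫_ℝ = 0 := fun p =>
      (Submodule.mem_orthogonal' _ _).1 hv _ (Submodule.subset_span ⟨p, rfl⟩)
    have hwu : ∀ p, ⟪w, u p⟫_ℝ = 0 := fun p =>
      (Submodule.mem_orthogonal' _ _).1 hw _ (Submodule.subset_span ⟨p, rfl⟩)
    refine ⟨fun p => Fin.cons (α := fun _ => E) (![v, w] p.1) (fun i => u (p.1, i)) p.2,
      ⟨?_, ?_⟩, ?_⟩
    · rintro ⟨a, i⟩
      refine Fin.cases ?_ (fun i => ?_) i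
      · fin_cases a
        · exact hv1
        · exact hw1
      · exact hu.1 (a, i)
    · rintro ⟨a, i⟩ ⟨b, j⟩
      refine Fin.cases ?_ (fun i => ?_) i <;> refine Fin.cases ?_ (fun j => ?_) j
      · fin_cases a <;> fin_cases b
        · simp
        · intro _
          exact hvw
        · intro _
          exact (real_inner_comm _ _).trans hvw
        · simp
      · intro _
        fin_cases a
        · exact hvu _
        · exact hwu _
      · intro _
        rw [real_inner_comm]
        fin_cases b
        · exact hvu _
        · exact hwu _
      · intro hne
        exact hu.2 fun h => hne (by simp_all)
    · intro i
      refine Fin.cases ?_ (fun i => ?_) i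
      · exact hr
      · exact hrot i

/-- A normal form for commuting isometries all of which are squares, if the dimension exceeds that
of the planes by at most one. -/
theorem exists_orthonormal_rotationPairs_fixed [FiniteDimensional ℝ E] {κ : Type*} [Subsingleton κ] [Fintype κ]
    (hρ : ∀ g x y, ⟪ρ g x, y⟫_ℝ = ⟪x, ρ g⁻¹ y⟫_ℝ)
    (hcomm : ∀ s ∈ T, ∀ t ∈ T, s * t = t * s) (hsq : ∀ t ∈ T, ∃ s ∈ T, s * s = t) (k : ℕ)
    (hk : 2 * k + Fintype.card κ = Module.finrank ℝ E) :
    ∃ u : (Fin 2 × Fin k) ⊕ κ → E, Orthonormal ℝ u ∧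
      (∀ i, IsRotationPair ρ T (u (Sum.inl (0, i))) (u (Sum.inl (1, i)))) ∧
      ∀ i, ∀ t ∈ T, ρ t (u (Sum.inr i)) = u (Sum.inr i) := by
  obtain ⟨u, hu, hrot⟩ := exists_orthonormal_rotationPairs hρ hcomm hsq k (by omega)
  have hspan := map_mem_span_of_rotationPairs hrot
  have hdim := Submodule.finrank_add_finrank_orthogonal (Submodule.span ℝ (Set.range u))
  rw [finrank_span_eq_card hu.linearIndependent] at hdim
  simp only [Fintype.card_prod, Fintype.card_fin] at hdim
  obtain ⟨x, hx⟩ : ∃ x : κ → E, ∀ i, x i ∈ (Submodule.span ℝ (Set.range u))ᗮ ∧ ‖x i‖ = 1 ∧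
      ∀ t ∈ T, ρ t (x i) = x i := by
    apply Classical.axiom_of_choice
      (r := fun (_ : κ) x => x ∈ (Submodule.span ℝ (Set.range u))ᗮ ∧ ‖x‖ = 1 ∧ ∀ t ∈ T, ρ t x = x)
    intro i
    -- An index in `κ` makes the leftover space a line. A line has no room for a rotation pair, so
    -- its unit vector must be fixed.
    have hcard : Fintype.card κ = 1 := Fintype.card_eq_one_iff.2 ⟨i, fun j => Subsingleton.elim _ _⟩
    have h1 : Module.finrank ℝ (Submodule.span ℝ (Set.range u))ᗮ = 1 := by omega
    obtain ⟨y, hy, hy1, hy2 | ⟨w, hw, hw1, hyw, -⟩⟩ := exists_fixed_or_rotationPair hρ hcomm hsq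
      (F := (Submodule.span ℝ (Set.range u))ᗮ)
      (fun t ht x hx => orthogonal_invariant hρ hspan ht hx) (by
        intro h0
        rw [h0, finrank_bot] at h1
        exact zero_ne_one h1)
    · exact ⟨y, hy, hy1, hy2⟩
    · have hy0 : (⟨y, hy⟩ : (Submodule.span ℝ (Set.range u))ᗮ) ≠ 0 := by
        intro h0
        have h2 : y = 0 := congrArg Subtype.val h0
        simp [h2] at hy1
      obtain ⟨c, hc⟩ := (finrank_eq_one_iff_of_nonzero' _ hy0).1 h1 ⟨w, hw⟩
      have hc' : c • y = w := congrArg Subtype.val hc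
      rw [← hc', inner_smul_right, real_inner_self_eq_norm_sq, hy1, one_pow, mul_one] at hyw
      rw [← hc', hyw, zero_smul, norm_zero] at hw1
      exact absurd hw1 zero_ne_one
  refine ⟨Sum.elim u x, ⟨?_, ?_⟩, hrot, fun i => (hx i).2.2⟩
  · rintro (p | i)
    · exact hu.1 p
    · exact (hx i).2.1
  · rintro (p | i) (q | j) hne
    · exact hu.2 fun h => hne (congrArg _ h)
    · exact (Submodule.mem_orthogonal _ _).1 (hx j).1 _ (Submodule.subset_span ⟨p, rfl⟩)
    · exact (Submodule.mem_orthogonal' _ _).1 (hx i).1 _ (Submodule.subset_span ⟨q, rfl⟩)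
    · exact absurd (congrArg Sum.inr (Subsingleton.elim i j)) hne

end Invariant

/-! ### Rotation blocks in orthogonal matrices -/

section Orthogonal

open Matrix

/-- Allows `circleExp` to be computed entry by entry in an algebra of diagonal or block data before
passing to matrices. -/
theorem circleExp_map {A B : Type*} [Ring A] [Algebra ℝ A] [Ring B] [Algebra ℝ B] {n : ℕ}
    (f : A →ₐ[ℝ] B) (H : Fin n → A) (z : Fin n → Circle) :
    circleExp (fun i => f (H i)) z = f (circleExp H z) := by
  simp [circleExp]

/-- The infinitesimal rotation of the plane. -/
def rotGen : Matrix (Fin 2) (Fin 2) ℝ := !![0, 1; -1, 0]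

/-- The rotation of the plane given by a point of the circle. -/
noncomputable def circleRot (z : Circle) : Matrix (Fin 2) (Fin 2) ℝ :=
  !![(z : ℂ).re, (z : ℂ).im; -(z : ℂ).im, (z : ℂ).re]

theorem rotGen_mul_self : rotGen * rotGen = -1 := by
  ext a b
  fin_cases a <;> fin_cases b <;> simp [rotGen, Matrix.mul_apply, Fin.sum_univ_two]

theorem rotGen_ne_zero : rotGen ≠ 0 := fun h => by
  simpa [rotGen] using congrFun (congrFun h 0) 1

theorem rotBlock_eq_circleRot (t : ℝ) : rotBlock t = circleRot (Circle.exp t) := by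
  simp [rotBlock, circleRot, Circle.coe_exp, Complex.exp_ofReal_mul_I_re,
    Complex.exp_ofReal_mul_I_im]

theorem exists_rotBlock_eq (z : Circle) : ∃ t, circleRot z = rotBlock t :=
  ⟨Complex.arg z, by rw [rotBlock_eq_circleRot, Circle.exp_arg]⟩

theorem circleRot_eq (z : Circle) :
    circleRot z = 1 + ((z : ℂ).im • rotGen + (1 - (z : ℂ).re) • (rotGen * rotGen)) := by
  rw [rotGen_mul_self]
  ext a b
  fin_cases a <;> fin_cases b <;> simp [rotGen, circleRot]

theorem det_circleRot (z : Circle) : (circleRot z).det = 1 := by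
  obtain ⟨t, ht⟩ := exists_rotBlock_eq z
  rw [ht, rotBlock_det]

/-- Orthogonal matrices commuting with the infinitesimal rotation are rotations. -/
theorem exists_circleRot_eq {B : Matrix (Fin 2) (Fin 2) ℝ} (hB : B * rotGen = rotGen * B)
    (hB' : B * Bᵀ = 1) : ∃ z, B = circleRot z := by
  have h00 := congrFun (congrFun hB 0) 0
  have h01 := congrFun (congrFun hB 0) 1
  have h1 := congrFun (congrFun hB' 0) 0
  simp [Matrix.mul_apply, Fin.sum_univ_two, rotGen] at h00 h01 h1
  obtain ⟨z, hz1, hz2⟩ := circle_of_sq_add_sq h1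
  refine ⟨z, ?_⟩
  ext a b
  fin_cases a <;> fin_cases b <;> simp [circleRot, hz1, hz2, h01, ← h00]

/-- The reflection for the sign `-1`, and the identity for the sign `1`. -/
def signBlock (u : ℤˣ) : Matrix (Fin 2) (Fin 2) ℝ := !![1, 0; 0, ((u : ℤ) : ℝ)]

theorem det_signBlock (u : ℤˣ) : (signBlock u).det = ((u : ℤ) : ℝ) := by
  simp [signBlock]

theorem signBlock_mul_transpose (u : ℤˣ) : signBlock u * (signBlock u)ᵀ = 1 := by
  rcases Int.units_eq_one_or u with rfl | rfl <;> ext a b <;> fin_cases a <;> fin_cases b <;>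
    simp [signBlock, Matrix.mul_apply, Fin.sum_univ_two]

theorem signBlock_mul_rotGen (u : ℤˣ) : signBlock u * rotGen = u • rotGen * signBlock u := by
  rcases Int.units_eq_one_or u with rfl | rfl <;> ext a b <;> fin_cases a <;> fin_cases b <;>
    simp [signBlock, rotGen, Matrix.mul_apply, Fin.sum_univ_two]

/-- A reflection of the plane inverts rotations. This keeps the normal form intact when a
conjugating matrix is corrected to determinant `1`. -/
theorem circleRot_mul_signBlock (u : ℤˣ) (z : Circle) :
    circleRot z * signBlock u = signBlock u * circleRot (z ^ (u : ℤ)) := by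
  rcases Int.units_eq_one_or u with rfl | rfl <;> ext a b <;> fin_cases a <;> fin_cases b <;>
    simp [signBlock, circleRot, Matrix.mul_apply, Fin.sum_univ_two]

/-! ### Block diagonal matrices, their generators and permutations of blocks -/

variable {n : ℕ} {κ m : Type*} [Fintype κ] [DecidableEq κ] [Fintype m] [DecidableEq m]
  (e : (Fin 2 × Fin n) ⊕ κ ≃ m)

/-- Block diagonal matrices with `2 × 2` blocks and a scalar. -/
def blockHom : ((Fin n → Matrix (Fin 2) (Fin 2) ℝ) × ℝ) →ₐ[ℝ] Matrix m m ℝ where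
  toFun x := reindex e e (fromBlocks (blockDiagonal x.1) 0 0 (diagonal fun _ => x.2))
  map_one' := by
    have h : blockDiagonal (1 : Fin n → Matrix (Fin 2) (Fin 2) ℝ) = 1 := blockDiagonal_one
    simp [h]
  map_mul' x y := by
    have h : blockDiagonal (x.1 * y.1) = blockDiagonal x.1 * blockDiagonal y.1 :=
      blockDiagonal_mul _ _
    simp only [reindex_apply, Prod.fst_mul, Prod.snd_mul, h, submatrix_mul_equiv,
      fromBlocks_multiply]
    simp
  map_zero' := by simp
  map_add' x y := by
    ext a b
    simp only [reindex_apply, submatrix_apply, Matrix.add_apply]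
    rcases e.symm a with p | k <;> rcases e.symm b with q | l <;> simp [diagonal_apply]
    split_ifs <;> simp
  commutes' r := by
    ext a b
    obtain ⟨a, rfl⟩ := e.surjective a
    obtain ⟨b, rfl⟩ := e.surjective b
    simp only [reindex_apply, submatrix_apply, Equiv.symm_apply_apply]
    rcases a with ⟨p, i⟩ | k <;> rcases b with ⟨q, j⟩ | l <;>
      simp [diagonal_apply, blockDiagonal_apply, Matrix.algebraMap_matrix_apply, Prod.ext_iff]
    · by_cases h : i = j <;> simp [h]

theorem blockHom_apply (x : (Fin n → Matrix (Fin 2) (Fin 2) ℝ) × ℝ) :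
    blockHom e x = reindex e e (fromBlocks (blockDiagonal x.1) 0 0 (diagonal fun _ => x.2)) := rfl

theorem blockHom_apply_apply (x : (Fin n → Matrix (Fin 2) (Fin 2) ℝ) × ℝ)
    (p q : (Fin 2 × Fin n) ⊕ κ) : blockHom e x (e p) (e q) =
      fromBlocks (blockDiagonal x.1) 0 0 (diagonal fun _ => x.2) p q := by
  simp [blockHom_apply]

theorem blockHom_fst_injective {x y : (Fin n → Matrix (Fin 2) (Fin 2) ℝ) × ℝ}
    (h : blockHom e x = blockHom e y) : x.1 = y.1 := by
  apply blockDiagonal_injective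
  have h1 := (reindex e e).injective h
  exact (fromBlocks_inj.1 h1).1

/-- The scalar is invisible without an extra index, which lets one formalism cover even and odd
size. -/
theorem blockHom_congr [IsEmpty κ] (B : Fin n → Matrix (Fin 2) (Fin 2) ℝ) (c d : ℝ) :
    blockHom e (B, c) = blockHom e (B, d) := by
  simp only [blockHom_apply]
  congr 2
  ext k
  exact isEmptyElim k

theorem transpose_blockHom (x : (Fin n → Matrix (Fin 2) (Fin 2) ℝ) × ℝ) :
    (blockHom e x)ᵀ = blockHom e (fun i => (x.1 i)ᵀ, x.2) := by
  simp [blockHom_apply, transpose_submatrix, fromBlocks_transpose, blockDiagonal_transpose]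

theorem det_blockHom (x : (Fin n → Matrix (Fin 2) (Fin 2) ℝ) × ℝ) :
    (blockHom e x).det = (∏ i, (x.1 i).det) * x.2 ^ Fintype.card κ := by
  rw [blockHom_apply, det_reindex_self, det_fromBlocks_zero₂₁, det_blockDiagonal, det_diagonal,
    Finset.prod_const, Finset.card_univ]

/-- The infinitesimal rotation in the `i`-th block. -/
def blockGen (i : Fin n) : Matrix m m ℝ := blockHom e (Pi.single i rotGen, 0)

theorem circleExp_blockGen (z : Fin n → Circle) :
    circleExp (blockGen e) z = blockHom e (fun i => circleRot (z i), 1) := by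
  change circleExp (fun i => blockHom e (Pi.single i rotGen, 0)) z = _
  rw [circleExp_map]
  congr 1
  refine Prod.ext ?_ ?_
  · funext k
    change _ = circleRot (z k)
    rw [circleRot_eq]
    simp only [circleExp, Prod.fst_add, Prod.fst_one, Prod.fst_sum, Pi.add_apply, Pi.one_apply,
      Finset.sum_apply]
    congr 1
    rw [Finset.sum_eq_single k]
    · simp
    · intro j _ hj
      simp [Pi.single_eq_of_ne hj.symm]
    · simp
  · simp [circleExp, Prod.snd_sum]

/-- Matrices commuting with the infinitesimal rotations in the blocks are block diagonal. -/
theorem exists_blockHom_eq_of_commute [Subsingleton κ] {A : Matrix m m ℝ}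
    (hA : ∀ i, A * blockGen e i = blockGen e i * A) :
    ∃ x, A = blockHom e x ∧ ∀ i, x.1 i * rotGen = rotGen * x.1 i := by
  have hl : ∀ i p q, (blockGen e i * A) (e p) (e q) =
      Sum.elim (fun a : Fin 2 × Fin n => if a.2 = i then
        ∑ b, rotGen a.1 b * A (e (Sum.inl (b, i))) (e q) else 0) (fun _ => 0) p := by
    intro i p q
    rw [Matrix.mul_apply, ← e.sum_comp, Fintype.sum_sum_type]
    simp only [blockGen, blockHom_apply_apply]
    rcases p with ⟨a, j⟩ | k
    · simp only [fromBlocks_apply₁₁, fromBlocks_apply₁₂, blockDiagonal_apply, Matrix.zero_apply,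
        zero_mul, Finset.sum_const_zero, add_zero, Sum.elim_inl, Fintype.sum_prod_type]
      refine (Finset.sum_congr rfl fun b _ => ?_).trans
        (b := ∑ b, if j = i then rotGen a b * A (e (Sum.inl (b, i))) (e q) else 0) ?_
      · rw [Finset.sum_eq_single j]
        · by_cases h : j = i
          · subst h
            simp
          · simp [h]
        · intro l _ hl
          simp [hl.symm]
        · simp
      · split_ifs <;> simp
    · simp
  have hr : ∀ i p q, (A * blockGen e i) (e p) (e q) =
      Sum.elim (fun a : Fin 2 × Fin n => if a.2 = i then
        ∑ b, A (e p) (e (Sum.inl (b, i))) * rotGen b a.1 else 0) (fun _ => 0) q := by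
    intro i p q
    rw [Matrix.mul_apply, ← e.sum_comp, Fintype.sum_sum_type]
    simp only [blockGen, blockHom_apply_apply]
    rcases q with ⟨a, j⟩ | k
    · simp only [fromBlocks_apply₁₁, fromBlocks_apply₂₁, blockDiagonal_apply, Matrix.zero_apply,
        mul_zero, Finset.sum_const_zero, add_zero, Sum.elim_inl, Fintype.sum_prod_type]
      refine (Finset.sum_congr rfl fun b _ => ?_).trans
        (b := ∑ b, if j = i then A (e p) (e (Sum.inl (b, i))) * rotGen b a else 0) ?_
      · rw [Finset.sum_eq_single j]
        · by_cases h : j = i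
          · subst h
            simp
          · simp [h]
        · intro l _ hl
          simp [hl]
        · simp
      · split_ifs <;> simp
    · simp
  have hcomm : ∀ i p q, (A * blockGen e i) (e p) (e q) = (blockGen e i * A) (e p) (e q) :=
    fun i p q => by rw [hA]
  simp only [hl, hr] at hcomm
  -- For a column outside block `i` the entry of `A * blockGen e i` is zero, while that of `blockGen
  -- e i * A` is, up to sign, the entry of `A` in the other row of the block.
  have hrow : ∀ i q, (∀ a, q ≠ Sum.inl (a, i)) → ∀ a, A (e (Sum.inl (a, i))) (e q) = 0 := by
    intro i q hq a
    have h := fun b => hcomm i (Sum.inl (b, i)) q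
    rcases q with ⟨c, j⟩ | k
    · have hji : j ≠ i := by
        rintro rfl
        exact hq c rfl
      simp [hji, rotGen, Fin.sum_univ_two] at h
      fin_cases a
      · exact h.2
      · exact h.1.symm
    · simp [rotGen, Fin.sum_univ_two] at h
      fin_cases a
      · exact h.2
      · exact h.1.symm
  have hcol : ∀ i k a, A (e (Sum.inr k)) (e (Sum.inl (a, i))) = 0 := by
    intro i k a
    have h := fun b => hcomm i (Sum.inr k) (Sum.inl (b, i))
    simp [rotGen, Fin.sum_univ_two] at h
    fin_cases a
    · exact h.2
    · exact h.1
  let B : Fin n → Matrix (Fin 2) (Fin 2) ℝ := fun i => Matrix.of fun a b =>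
    A (e (Sum.inl (a, i))) (e (Sum.inl (b, i)))
  obtain ⟨c, hc⟩ : ∃ c, ∀ k, A (e (Sum.inr k)) (e (Sum.inr k)) = c := by
    rcases isEmpty_or_nonempty κ with h | ⟨⟨k⟩⟩
    · exact ⟨0, fun k => isEmptyElim k⟩
    · exact ⟨_, fun l => by rw [Subsingleton.elim l k]⟩
  refine ⟨(B, c), ?_, fun i => ?_⟩
  · ext x y
    obtain ⟨p, rfl⟩ := e.surjective x
    obtain ⟨q, rfl⟩ := e.surjective y
    rw [blockHom_apply_apply]
    rcases p with ⟨a, i⟩ | k <;> rcases q with ⟨b, j⟩ | l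
    · rw [fromBlocks_apply₁₁]
      by_cases hij : i = j
      · subst hij
        simp [B]
      · rw [blockDiagonal_apply_ne _ _ _ hij]
        exact hrow i _ (fun a h => hij (by simp_all)) a
    · exact hrow i _ (fun a h => by simp at h) a
    · exact hcol j k b
    · rw [Subsingleton.elim l k, fromBlocks_apply₂₂, diagonal_apply_eq]
      exact hc k
  · ext a b
    have h := hcomm i (Sum.inl (a, i)) (Sum.inl (b, i))
    simpa [Matrix.mul_apply, B] using h

variable {e} in
theorem exists_circleRot_of_commute [Subsingleton κ] {A : Matrix m m ℝ} (hAA : A * Aᵀ = 1)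
    (hA : ∀ i, A * blockGen e i = blockGen e i * A) :
    ∃ (z : Fin n → Circle) (c : ℝ), A = blockHom e (fun i => circleRot (z i), c) := by
  obtain ⟨⟨B, c⟩, rfl, hB⟩ := exists_blockHom_eq_of_commute e hA
  rw [transpose_blockHom, ← map_mul, ← map_one (blockHom e)] at hAA
  have h1 := blockHom_fst_injective e hAA
  choose z hz using fun i => exists_circleRot_eq (hB i) (congrFun h1 i)
  exact ⟨z, c, by rw [← funext hz]⟩

/-- The permutation of the blocks. -/
def blockPerm (σ : Equiv.Perm (Fin n)) : Matrix m m ℝ :=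
  (e.permCongr (Equiv.sumCongr (Equiv.prodCongrRight fun _ : Fin 2 => σ.symm)
    (1 : Equiv.Perm κ))).permMatrix ℝ

theorem blockPerm_mul_blockHom (σ : Equiv.Perm (Fin n))
    (x : (Fin n → Matrix (Fin 2) (Fin 2) ℝ) × ℝ) :
    blockPerm e σ * blockHom e x = blockHom e (x.1 ∘ σ.symm, x.2) * blockPerm e σ := by
  rw [blockPerm, Equiv.Perm.permMatrix, PEquiv.toMatrix_toPEquiv_mul, PEquiv.mul_toMatrix_toPEquiv]
  set τ := Equiv.sumCongr (Equiv.prodCongrRight fun _ : Fin 2 => σ.symm) (1 : Equiv.Perm κ) with hτ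
  ext a b
  obtain ⟨p, rfl⟩ := e.surjective a
  obtain ⟨q, rfl⟩ := (τ.trans e).surjective b
  have h1 : (e.permCongr τ).symm ((τ.trans e) q) = e q := by
    rw [Equiv.symm_apply_eq]
    simp
  have h2 : e.permCongr τ (e p) = e (τ p) := by simp
  rw [submatrix_apply, submatrix_apply, h1, h2, id, id, Equiv.trans_apply, blockHom_apply_apply,
    blockHom_apply_apply]
  rcases p with ⟨a, i⟩ | k <;> rcases q with ⟨b, j⟩ | l <;>
    simp [hτ, blockDiagonal_apply]

/-- Permuting blocks of size two performs the same permutation on two copies of `Fin n`, so its sign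
is a square. -/
theorem det_blockPerm (σ : Equiv.Perm (Fin n)) : (blockPerm e σ).det = 1 := by
  rw [blockPerm, det_permutation, Equiv.Perm.sign_permCongr]
  have h := Equiv.Perm.sign_sumCongr (Equiv.prodCongrRight fun _ : Fin 2 => σ.symm)
    (1 : Equiv.Perm κ)
  change Equiv.Perm.sign (Equiv.sumCongr _ _) = _ at h
  rw [h, Equiv.Perm.sign_prodCongrRight]
  simp

/-- Signed permutations of the blocks are realized by orthogonal matrices. -/
theorem exists_orthogonal_signed (σ : Equiv.Perm (Fin n)) (ε : Fin n → ℤˣ) {c : ℝ}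
    (hc : c * c = 1) :
    ∃ A : Matrix m m ℝ, A * Aᵀ = 1 ∧ A.det = ((∏ i, ε i : ℤˣ) : ℤ) * c ^ Fintype.card κ ∧
      ∀ i, A * blockGen e i = ε i • blockGen e (σ i) * A := by
  -- First reflect the planes with negative sign, which reverses their generators and contributes
  -- the product of signs to the determinant. Then permute the planes.
  refine ⟨blockPerm e σ * blockHom e (fun i => signBlock (ε i), c), ?_, ?_, fun i => ?_⟩
  · rw [transpose_mul, Matrix.mul_assoc, ← Matrix.mul_assoc _ _ (blockPerm e σ)ᵀ,
      transpose_blockHom, ← map_mul]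
    have h : ((fun i => signBlock (ε i), c) : (Fin n → Matrix (Fin 2) (Fin 2) ℝ) × ℝ) *
        (fun i => (signBlock (ε i))ᵀ, c) = 1 :=
      Prod.ext (funext fun i => signBlock_mul_transpose (ε i)) hc
    rw [h, map_one, Matrix.one_mul, blockPerm, transpose_permMatrix, ← permMatrix_mul,
      inv_mul_cancel, permMatrix_one]
  · rw [det_mul, det_blockPerm, one_mul, det_blockHom]
    simp [det_signBlock]
  · have h1 : ((fun i => signBlock (ε i), c) : (Fin n → Matrix (Fin 2) (Fin 2) ℝ) × ℝ) *
        (Pi.single i rotGen, 0) = ε i • (Pi.single i rotGen, 0) * (fun i => signBlock (ε i), c) := by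
      refine Prod.ext (funext fun j => ?_) (by simp)
      by_cases hj : j = i
      · subst hj
        simpa using signBlock_mul_rotGen (ε j)
      · simp [Pi.single_eq_of_ne hj]
    have h2 : blockPerm e σ * blockGen e i = blockGen e (σ i) * blockPerm e σ := by
      rw [blockGen, blockPerm_mul_blockHom, blockGen]
      congr 3
      funext j
      simp [Pi.single_apply, Equiv.symm_apply_eq]
    rw [Matrix.mul_assoc, blockGen, ← map_mul, h1, map_mul]
    have h3 : blockHom e (ε i • ((Pi.single i rotGen, 0) :
        (Fin n → Matrix (Fin 2) (Fin 2) ℝ) × ℝ)) = ε i • blockGen e i := by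
      rcases Int.units_eq_one_or (ε i) with hε | hε 
      · simp [hε, blockGen]
      · rw [hε, Units.neg_smul, one_smul, map_neg, Units.neg_smul, one_smul, blockGen]
    rw [h3, ← Matrix.mul_assoc, ← Matrix.mul_assoc]
    rcases Int.units_eq_one_or (ε i) with hε | hε <;> simp [hε, h2]

end Orthogonal

/-! ### Special orthogonal groups -/

section SpecialOrthogonal

open Matrix

open scoped InnerProductSpace

variable {n : ℕ} {κ m : Type*} [Fintype κ] [DecidableEq κ] [Fintype m] [DecidableEq m]

theorem coe_mul_transpose (g : specialOrthogonalGroup m ℝ) :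
    (g : Matrix m m ℝ) * (g : Matrix m m ℝ)ᵀ = 1 :=
  (mem_orthogonalGroup_iff m ℝ).1 (mem_specialOrthogonalGroup_iff.1 g.2).1

theorem det_coe (g : specialOrthogonalGroup m ℝ) : (g : Matrix m m ℝ).det = 1 :=
  (mem_specialOrthogonalGroup_iff.1 g.2).2

theorem coe_inv_eq_transpose (g : specialOrthogonalGroup m ℝ) :
    ((g⁻¹ : specialOrthogonalGroup m ℝ) : Matrix m m ℝ) = (g : Matrix m m ℝ)ᵀ := by
  refine left_inv_eq_right_inv (a := (g : Matrix m m ℝ)) ?_ (coe_mul_transpose g)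
  rw [← Submonoid.coe_mul, inv_mul_cancel]
  rfl

theorem mem_of_transpose {A : Matrix m m ℝ} (h : A * Aᵀ = 1) (hd : A.det = 1) :
    A ∈ specialOrthogonalGroup m ℝ :=
  mem_specialOrthogonalGroup_iff.2 ⟨(mem_orthogonalGroup_iff m ℝ).2 h, hd⟩

variable (m) in
/-- The action of the special orthogonal group on Euclidean space. -/
noncomputable def euclideanHom :
    specialOrthogonalGroup m ℝ →* Module.End ℝ (EuclideanSpace ℝ m) where
  toFun g := toEuclideanLin (g : Matrix m m ℝ)
  map_one' := by
    ext x i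
    simp
  map_mul' g h := by
    refine LinearMap.ext fun x => ?_
    simp [toLpLin_apply]

theorem inner_euclideanHom (g : specialOrthogonalGroup m ℝ) (x y : EuclideanSpace ℝ m) :
    ⟪euclideanHom m g x, y⟫_ℝ = ⟪x, euclideanHom m g⁻¹ y⟫_ℝ := by
  change ⟪toEuclideanLin (g : Matrix m m ℝ) x, y⟫_ℝ = ⟪x, toEuclideanLin _ y⟫_ℝ
  rw [coe_inv_eq_transpose, ← conjTranspose_eq_transpose_of_trivial,
    toEuclideanLin_conjTranspose_eq_adjoint, LinearMap.adjoint_inner_right]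

variable (e : (Fin 2 × Fin n) ⊕ κ ≃ m)

/-- Commuting special orthogonal matrices all of which are squares are conjugate to matrices of
rotation blocks by an orthogonal matrix. -/
theorem exists_orthogonal_conj [Subsingleton κ] (T : Subgroup (specialOrthogonalGroup m ℝ))
    (hcomm : ∀ s ∈ T, ∀ t ∈ T, s * t = t * s) (hsq : ∀ t ∈ T, ∃ s ∈ T, s * s = t) :
    ∃ A : Matrix m m ℝ, A * Aᵀ = 1 ∧ ∀ t ∈ T, ∃ z : Fin n → Circle,
      (t : Matrix m m ℝ) * A = A * blockHom e (fun i => circleRot (z i), 1) := by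
  obtain ⟨u, hu, hrot, hfix⟩ := exists_orthonormal_rotationPairs_fixed (κ := κ) inner_euclideanHom
    hcomm hsq n (by
      rw [finrank_euclideanSpace, ← Fintype.card_congr e]
      simp)
  -- The columns of `A` are the orthonormal basis adapted to the invariant planes.
  let A : Matrix m m ℝ := Matrix.of fun x y => u (e.symm y) x
  have hA : Aᵀ * A = 1 := by
    ext x y
    have h1 : (Aᵀ * A) x y = ⟪u (e.symm y), u (e.symm x)⟫_ℝ := by
      simp only [Matrix.mul_apply, PiLp.inner_apply, A, transpose_apply, of_apply]
      rfl
    rw [h1, orthonormal_iff_ite.1 hu, one_apply]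
    simp [eq_comm]
  refine ⟨A, mul_eq_one_comm.1 hA, fun t ht => ?_⟩
  choose z hz0 hz1 using fun i => hrot i t ht
  refine ⟨z, ?_⟩
  ext x y
  obtain ⟨p, rfl⟩ := e.surjective y
  have h1 : ((t : Matrix m m ℝ) * A) x (e p) = euclideanHom m t (u p) x := by
    change _ = ((t : Matrix m m ℝ) *ᵥ (u p).ofLp) x
    simp [Matrix.mul_apply, mulVec, dotProduct, A]
  have h2 : (A * blockHom e (fun i => circleRot (z i), 1)) x (e p) =
      ∑ q, u q x * fromBlocks (blockDiagonal fun i => circleRot (z i)) 0 0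
        (diagonal fun _ => (1 : ℝ)) q p := by
    rw [Matrix.mul_apply, ← e.sum_comp]
    simp [blockHom_apply_apply, A]
  rw [h1, h2, Fintype.sum_sum_type]
  rcases p with ⟨a, i⟩ | k
  · simp only [fromBlocks_apply₁₁, fromBlocks_apply₂₁, Matrix.zero_apply, mul_zero,
      Finset.sum_const_zero, add_zero, Fintype.sum_prod_type, blockDiagonal_apply, mul_ite,
      Finset.sum_ite_eq', Finset.mem_univ, if_true, Fin.sum_univ_two]
    fin_cases a
    · change euclideanHom m t (u (Sum.inl (0, i))) x = _
      rw [hz0 i]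
      simp [circleRot]
      ring
    · change euclideanHom m t (u (Sum.inl (1, i))) x = _
      rw [hz1 i]
      simp [circleRot]
      ring
  · rw [hfix k t ht]
    simp [one_apply]

/-- Every torus in a special orthogonal group is conjugate to a group of rotation blocks. -/
theorem IsTorus.exists_conj_specialOrthogonal [Subsingleton κ] (hn : 0 < n)
    {T : Subgroup (specialOrthogonalGroup m ℝ)} (hT : IsTorus T) :
    ∃ g : specialOrthogonalGroup m ℝ, ∀ t ∈ T, ∃ z : Fin n → Circle,
      ((g⁻¹ * t * g : specialOrthogonalGroup m ℝ) : Matrix m m ℝ) =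
        blockHom e (fun i => circleRot (z i), 1) := by
  obtain ⟨A, hAA, hA⟩ := exists_orthogonal_conj e T (fun s hs t ht => hT.commute hs ht)
    fun t ht => hT.exists_mul_self_eq ht
  have key : ∀ (B : Matrix m m ℝ) (hBB : B * Bᵀ = 1) (hd : B.det = 1), (∀ t ∈ T,
      ∃ z : Fin n → Circle, (t : Matrix m m ℝ) * B = B * blockHom e (fun i => circleRot (z i), 1)) →
      ∃ g : specialOrthogonalGroup m ℝ, ∀ t ∈ T, ∃ z : Fin n → Circle,
        ((g⁻¹ * t * g : specialOrthogonalGroup m ℝ) : Matrix m m ℝ) =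
          blockHom e (fun i => circleRot (z i), 1) := by
    intro B hBB hd hB
    refine ⟨⟨B, mem_of_transpose hBB hd⟩, fun t ht => ?_⟩
    obtain ⟨z, hz⟩ := hB t ht
    refine ⟨z, ?_⟩
    rw [Submonoid.coe_mul, Submonoid.coe_mul, coe_inv_eq_transpose, Matrix.mul_assoc, hz,
      ← Matrix.mul_assoc, mul_eq_one_comm.1 hBB, Matrix.one_mul]
  have hdet : A.det * A.det = 1 := by
    rw [← det_one (n := m) (R := ℝ), ← hAA, det_mul, det_transpose]
  rcases mul_self_eq_one_iff.1 hdet with hd | hd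
  · exact key A hAA hd hA
  -- If the basis has determinant `-1`, a reflection in the first plane corrects it at the cost of
  -- inverting one rotation. This is where `0 < n` is needed.
  · let ε : Fin n → ℤˣ := Function.update 1 ⟨0, hn⟩ (-1)
    let K : Matrix m m ℝ := blockHom e (fun i => signBlock (ε i), 1)
    have hKK : K * Kᵀ = 1 := by
      rw [transpose_blockHom, ← map_mul, ← map_one (blockHom e)]
      exact congrArg _ (Prod.ext (funext fun i => signBlock_mul_transpose (ε i)) (mul_one 1))
    have hKd : K.det = -1 := by
      rw [det_blockHom]
      simp only [det_signBlock, one_pow, mul_one]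
      rw [Finset.prod_eq_single ⟨0, hn⟩]
      · simp [ε]
      · intro i _ hi
        simp [ε, Function.update_of_ne hi]
      · simp
    refine key (A * K) ?_ (by rw [det_mul, hd, hKd]; norm_num) fun t ht => ?_
    · rw [transpose_mul, Matrix.mul_assoc, ← Matrix.mul_assoc K, hKK, Matrix.one_mul, hAA]
    · obtain ⟨z, hz⟩ := hA t ht
      refine ⟨fun i => z i ^ (ε i : ℤ), ?_⟩
      rw [← Matrix.mul_assoc, hz, Matrix.mul_assoc, Matrix.mul_assoc, ← map_mul, ← map_mul]
      exact congrArg (fun x => A * blockHom e x)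
        (Prod.ext (funext fun i => circleRot_mul_signBlock (ε i) (z i)) rfl)

variable {e}

/-- The groups of rotation blocks are tori in special orthogonal groups. -/
theorem isTorusFrame_specialOrthogonal [Subsingleton κ]
    {T : Subgroup (specialOrthogonalGroup m ℝ)}
    (hT : ∀ g, g ∈ T ↔ ∃ θ : Fin n → ℝ, (g : Matrix m m ℝ) =
      blockHom e (fun i => rotBlock (θ i), 1)) :
    IsTorusFrame (specialOrthogonalGroup m ℝ).subtype T (blockGen e) where
  injective := Subtype.val_injective
  mul_eq_zero i j hij := by
    have h : ((Pi.single i rotGen, 0) : (Fin n → Matrix (Fin 2) (Fin 2) ℝ) × ℝ) *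
        (Pi.single j rotGen, 0) = 0 := by
      refine Prod.ext (funext fun k => ?_) (mul_zero 0)
      by_cases hk : k = i
      · subst hk
        simp [Pi.single_eq_of_ne hij]
      · simp [Pi.single_eq_of_ne hk]
    rw [blockGen, blockGen, ← map_mul, h, map_zero]
  cube i := by
    rw [blockGen, ← map_mul, ← map_mul, ← map_neg]
    refine congrArg _ (Prod.ext (funext fun k => ?_) (by simp))
    by_cases hk : k = i
    · subst hk
      simp [rotGen_mul_self]
    · simp [Pi.single_eq_of_ne hk]
  ne_zero i h := by
    rw [blockGen, ← map_zero (blockHom e)] at h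
    have h1 := congrFun (blockHom_fst_injective e h) i
    exact rotGen_ne_zero (by simpa using h1)
  mem_iff g := by
    rw [hT]
    constructor
    · rintro ⟨θ, hθ⟩
      refine ⟨fun i => Circle.exp (θ i), ?_⟩
      rw [circleExp_blockGen]
      simp only [rotBlock_eq_circleRot] at hθ
      exact hθ
    · rintro ⟨z, hz⟩
      choose θ hθ using fun i => exists_rotBlock_eq (z i)
      refine ⟨θ, ?_⟩
      rw [circleExp_blockGen] at hz
      simp only [hθ] at hz
      exact hz
  exists_eq z := by
    refine ⟨⟨circleExp (blockGen e) z, ?_⟩, rfl⟩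
    rw [circleExp_blockGen]
    refine mem_of_transpose ?_ ?_
    · rw [transpose_blockHom, ← map_mul, ← map_one (blockHom e)]
      refine congrArg _ (Prod.ext (funext fun i => ?_) (mul_one 1))
      obtain ⟨t, ht⟩ := exists_rotBlock_eq (z i)
      change circleRot (z i) * (circleRot (z i))ᵀ = 1
      rw [ht, rotBlock_transpose, rotBlock_add, add_neg_cancel, rotBlock_zero]
    · rw [det_blockHom]
      simp [det_circleRot]
  centralizer g hg := by
    obtain ⟨z, c, hz⟩ := exists_circleRot_of_commute (coe_mul_transpose g) hg
    choose θ hθ using fun i => exists_rotBlock_eq (z i)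
    have hd := det_coe g
    rw [hz, det_blockHom] at hd
    simp only [det_circleRot, Finset.prod_const_one, one_mul] at hd
    refine (hT g).2 ⟨θ, ?_⟩
    rw [hz]
    simp only [hθ]
    -- The extra diagonal entry is either absent or equal to the determinant, hence `1`.
    rcases isEmpty_or_nonempty κ with h | ⟨⟨k⟩⟩
    · exact blockHom_congr e _ _ _
    · rw [Fintype.card_eq_one_iff.2 ⟨k, fun l => Subsingleton.elim l k⟩, pow_one] at hd
      rw [hd]

/-- With an extra fixed vector, all signed permutations are realized. -/
theorem exists_specialOrthogonal_signed [Unique κ] (σ : Equiv.Perm (Fin n)) (ε : Fin n → ℤˣ) :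
    ∃ g : specialOrthogonalGroup m ℝ, ∀ i, (g : Matrix m m ℝ) * blockGen e i =
      ε i • blockGen e (σ i) * (g : Matrix m m ℝ) := by
  have hu : (((∏ i, ε i : ℤˣ) : ℤ) : ℝ) * (((∏ i, ε i : ℤˣ) : ℤ) : ℝ) = 1 := by
    rw [← Int.cast_mul, ← Units.val_mul, Int.units_mul_self]
    simp
  -- The extra diagonal entry is chosen as the product of the signs, so that the determinant becomes
  -- its square.
  obtain ⟨A, hA, hd, hAH⟩ := exists_orthogonal_signed e σ ε hu
  refine ⟨⟨A, mem_of_transpose hA ?_⟩, hAH⟩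
  rw [hd, Fintype.card_unique, pow_one, hu]

/-- In even dimensions, exactly the signed permutations with an even number of signs are
realized. -/
theorem prod_eq_one_iff_exists_specialOrthogonal [IsEmpty κ] (σ : Equiv.Perm (Fin n))
    (ε : Fin n → ℤˣ) : ∏ i, ε i = 1 ↔ ∃ g : specialOrthogonalGroup m ℝ, ∀ i,
      (g : Matrix m m ℝ) * blockGen e i = ε i • blockGen e (σ i) * (g : Matrix m m ℝ) := by
  obtain ⟨A, hA, hd, hAH⟩ := exists_orthogonal_signed e σ ε (mul_one 1)
  rw [one_pow, mul_one] at hd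
  constructor
  · intro hε
    refine ⟨⟨A, mem_of_transpose hA ?_⟩, hAH⟩
    rw [hd, hε]
    simp
  · rintro ⟨g, hg⟩
    have hA' : Aᵀ * A = 1 := mul_eq_one_comm.1 hA
    -- `A` and `g` induce the same signed permutation, so `Aᵀ * g` centralizes the generators and
    -- consists of rotation blocks. Its determinant is `1`, and hence `det A = det g = 1`.
    have hcomm : ∀ i, (Aᵀ * (g : Matrix m m ℝ)) * blockGen e i =
        blockGen e i * (Aᵀ * (g : Matrix m m ℝ)) := by
      intro i
      have h1 : Aᵀ * (ε i • blockGen e (σ i)) = blockGen e i * Aᵀ := by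
        calc _ = Aᵀ * (ε i • blockGen e (σ i) * A) * Aᵀ := by
              rw [Matrix.mul_assoc, Matrix.mul_assoc, hA, Matrix.mul_one]
          _ = _ := by rw [← hAH, ← Matrix.mul_assoc, hA', Matrix.one_mul]
      rw [Matrix.mul_assoc, hg, ← Matrix.mul_assoc, h1, Matrix.mul_assoc]
    obtain ⟨z, c, hz⟩ := exists_circleRot_of_commute (A := Aᵀ * (g : Matrix m m ℝ)) (by
      rw [transpose_mul, transpose_transpose, Matrix.mul_assoc, ← Matrix.mul_assoc _ _ A,
        coe_mul_transpose, Matrix.one_mul, hA']) hcomm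
    have h1 := congrArg det hz
    rw [det_mul, det_transpose, det_coe, hd, det_blockHom] at h1
    simp only [det_circleRot, Finset.prod_const_one, mul_one, Fintype.card_eq_zero,
      pow_zero] at h1
    refine Units.ext (Int.cast_injective (α := ℝ) ?_)
    rw [h1, Units.val_one, Int.cast_one]

/-! ### The standard tori of `SO(2n)` and `SO(2n+1)` -/

/-- The indices of the blocks of size two in even dimensions. -/
def evenBlockIdx (n : ℕ) : (Fin 2 × Fin n) ⊕ Fin 0 ≃ Fin (2 * n) :=
  (Equiv.sumEmpty _ _).trans (evenIdx n)

/-- The scalar `c` is free because `Fin 0` is empty. It is taken to be `0` for the generators and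
`1` for the torus. -/
theorem evenDiag_eq_blockHom (B : Fin n → Matrix (Fin 2) (Fin 2) ℝ) (c : ℝ) :
    evenDiag B = blockHom (evenBlockIdx n) (B, c) := by
  ext a b
  obtain ⟨p, rfl⟩ := (evenIdx n).surjective a
  obtain ⟨q, rfl⟩ := (evenIdx n).surjective b
  have h : ∀ p, evenIdx n p = evenBlockIdx n (Sum.inl p) := fun p => rfl
  have h2 : evenDiag B (evenIdx n p) (evenIdx n q) = blockDiagonal B p q := by
    simp [evenDiag]
  rw [h2, h, h, blockHom_apply_apply, fromBlocks_apply₁₁]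

theorem evenH_eq_blockGen : evenH n = blockGen (evenBlockIdx n) :=
  funext fun _ => evenDiag_eq_blockHom _ 0

theorem oddH_eq_blockGen : oddH n = blockGen (oddIdx n) := rfl

theorem isTorusFrame_evenTorus (n : ℕ) :
    IsTorusFrame (specialOrthogonalGroup (Fin (2 * n)) ℝ).subtype (evenTorus n) (evenH n) := by
  rw [evenH_eq_blockGen]
  refine isTorusFrame_specialOrthogonal fun g => ?_
  simp only [← evenDiag_eq_blockHom]
  rfl

theorem isTorusFrame_oddTorus (n : ℕ) :
    IsTorusFrame (specialOrthogonalGroup (Fin (2 * n + 1)) ℝ).subtype (oddTorus n) (oddH n) :=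
  isTorusFrame_specialOrthogonal fun _ => Iff.rfl

theorem weylGroupActsAs_evenTorus (n : ℕ) :
    WeylGroupActsAs (specialOrthogonalGroup (Fin (2 * n)) ℝ).subtype (evenTorus n) (evenH n)
      (evenSignedPerms (evenH n)) := by
  rw [← (isTorusFrame_evenTorus n).signIndependent.image_perm]
  refine (isTorusFrame_evenTorus n).weylGroupActsAs _ fun x => ?_
  rw [evenH_eq_blockGen]
  exact prod_eq_one_iff_exists_specialOrthogonal x.1 x.2

theorem weylGroupActsAs_oddTorus (n : ℕ) :
    WeylGroupActsAs (specialOrthogonalGroup (Fin (2 * n + 1)) ℝ).subtype (oddTorus n) (oddH n)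
      (signedPerms (oddH n)) := by
  rw [← (isTorusFrame_oddTorus n).signIndependent.range_perm, ← Set.image_univ]
  exact (isTorusFrame_oddTorus n).weylGroupActsAs _ fun x =>
    ⟨fun _ => exists_specialOrthogonal_signed x.1 x.2, fun _ => Set.mem_univ _⟩

theorem exists_conj_mem_evenTorus (hn : 0 < n) (T : Subgroup (SO (2 * n))) (hT : IsTorus T) :
    ∃ g : SO (2 * n), ∀ t ∈ T, g⁻¹ * t * g ∈ evenTorus n := by
  obtain ⟨g, hg⟩ := hT.exists_conj_specialOrthogonal (evenBlockIdx n) hn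
  refine ⟨g, fun t ht => ?_⟩
  obtain ⟨z, hz⟩ := hg t ht
  rw [(isTorusFrame_evenTorus n).mem_iff, evenH_eq_blockGen]
  exact ⟨z, hz.trans (circleExp_blockGen _ z).symm⟩

theorem exists_conj_mem_oddTorus (hn : 0 < n) (T : Subgroup (SO (2 * n + 1))) (hT : IsTorus T) :
    ∃ g : SO (2 * n + 1), ∀ t ∈ T, g⁻¹ * t * g ∈ oddTorus n := by
  obtain ⟨g, hg⟩ := hT.exists_conj_specialOrthogonal (oddIdx n) hn
  refine ⟨g, fun t ht => ?_⟩
  obtain ⟨z, hz⟩ := hg t ht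
  rw [(isTorusFrame_oddTorus n).mem_iff, oddH_eq_blockGen]
  exact ⟨z, hz.trans (circleExp_blockGen _ z).symm⟩

end SpecialOrthogonal

/-! ### The group `Sp(n)` -/

section Symplectic

open Matrix

open scoped InnerProductSpace

variable {n : ℕ}

/-- The quaternion `i`. -/
def quatI : ℍ[ℝ] := ⟨0, 1, 0, 0⟩

/-- Points of the circle as quaternions. -/
noncomputable def circleQuat (z : Circle) : ℍ[ℝ] := ⟨(z : ℂ).re, (z : ℂ).im, 0, 0⟩

@[simp] theorem re_quatI : quatI.re = 0 := rfl

@[simp] theorem imI_quatI : quatI.imI = 1 := rfl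

@[simp] theorem imJ_quatI : quatI.imJ = 0 := rfl

@[simp] theorem imK_quatI : quatI.imK = 0 := rfl

@[simp] theorem re_circleQuat (z : Circle) : (circleQuat z).re = (z : ℂ).re := rfl

@[simp] theorem imI_circleQuat (z : Circle) : (circleQuat z).imI = (z : ℂ).im := rfl

@[simp] theorem imJ_circleQuat (z : Circle) : (circleQuat z).imJ = 0 := rfl

@[simp] theorem imK_circleQuat (z : Circle) : (circleQuat z).imK = 0 := rfl

/-- The quaternion `j`. -/
def quatJ : ℍ[ℝ] := ⟨0, 0, 1, 0⟩

@[simp] theorem re_quatJ : quatJ.re = 0 := rfl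

@[simp] theorem imI_quatJ : quatJ.imI = 0 := rfl

@[simp] theorem imJ_quatJ : quatJ.imJ = 1 := rfl

@[simp] theorem imK_quatJ : quatJ.imK = 0 := rfl

theorem quatI_mul_self : quatI * quatI = -1 := by
  ext
  · rw [Quaternion.re_mul]; simp
  · rw [Quaternion.imI_mul]; simp
  · rw [Quaternion.imJ_mul]; simp
  · rw [Quaternion.imK_mul]; simp

theorem star_quatI : star quatI = -quatI := by
  ext <;> simp

theorem quatI_ne_zero : quatI ≠ 0 := fun h => by
  simpa using congrArg QuaternionAlgebra.imI h

theorem circleQuat_eq (z : Circle) :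
    circleQuat z = 1 + ((z : ℂ).im • quatI + (1 - (z : ℂ).re) • (quatI * quatI)) := by
  rw [quatI_mul_self]
  ext <;> simp

theorem expI_eq_circleQuat (t : ℝ) : expI t = circleQuat (Circle.exp t) := by
  have h : ((Circle.exp t : Circle) : ℂ) = Complex.exp (t * Complex.I) := Circle.coe_exp t
  rw [circleQuat, h, Complex.exp_ofReal_mul_I_re, Complex.exp_ofReal_mul_I_im]
  rfl

theorem exists_expI_eq (z : Circle) : ∃ t, circleQuat z = expI t :=
  ⟨Complex.arg z, by rw [expI_eq_circleQuat, Circle.exp_arg]⟩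

theorem star_circleQuat_mul (z : Circle) : star (circleQuat z) * circleQuat z = 1 := by
  rw [Quaternion.star_mul_self]
  have h : Quaternion.normSq (circleQuat z) = 1 := by
    rw [Quaternion.normSq_def']
    have := Circle.normSq_coe z
    rw [Complex.normSq_apply] at this
    simp only [re_circleQuat, imI_circleQuat, imJ_circleQuat, imK_circleQuat]
    linarith
  rw [h, Quaternion.coe_one]

/-- Unit quaternions commuting with `i` are complex numbers. -/
theorem exists_circleQuat_eq {q : ℍ[ℝ]} (hq : q * quatI = quatI * q) (h1 : star q * q = 1) :
    ∃ z, q = circleQuat z := by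
  have hJ := congrArg QuaternionAlgebra.imJ hq
  have hK := congrArg QuaternionAlgebra.imK hq
  rw [Quaternion.imJ_mul, Quaternion.imJ_mul] at hJ
  rw [Quaternion.imK_mul, Quaternion.imK_mul] at hK
  simp at hJ hK
  have hJ0 : q.imJ = 0 := by linarith
  have hK0 : q.imK = 0 := by linarith
  rw [Quaternion.star_mul_self] at h1
  have h2 := congrArg QuaternionAlgebra.re h1
  rw [Quaternion.re_coe, Quaternion.normSq_def', hJ0, hK0] at h2
  obtain ⟨z, hz1, hz2⟩ := circle_of_sq_add_sq (a := q.re) (b := q.imI) (by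
    rw [Quaternion.re_one] at h2
    linarith)
  exact ⟨z, by ext <;> simp [hz1, hz2, hJ0, hK0]⟩

/-! ### Quaternionic column vectors and simultaneous diagonalization -/

theorem quaternion_re_mul_comm (p q : ℍ[ℝ]) : (p * q).re = (q * p).re := by
  rw [Quaternion.re_mul, Quaternion.re_mul]
  ring

/-- Quaternionic column vectors as a Euclidean space. -/
abbrev QuatSpace (n : ℕ) : Type := PiLp 2 fun _ : Fin n => ℍ[ℝ]

variable (n) in
/-- The action of quaternionic matrices on column vectors. -/
noncomputable def quatMulVec : Matrix (Fin n) (Fin n) ℍ[ℝ] →* Module.End ℝ (QuatSpace n) where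
  toFun A :=
    { toFun := fun x => WithLp.toLp 2 (A *ᵥ x.ofLp)
      map_add' := fun x y => by
        ext1
        simp [mulVec_add]
      map_smul' := fun c x => by
        ext1
        simp [mulVec_smul] }
  map_one' := by
    refine LinearMap.ext fun x => ?_
    ext1
    simp
  map_mul' A B := by
    refine LinearMap.ext fun x => ?_
    ext1
    simp

theorem ofLp_quatMulVec (A : Matrix (Fin n) (Fin n) ℍ[ℝ]) (x : QuatSpace n) :
    (quatMulVec n A x).ofLp = A *ᵥ x.ofLp := rfl

variable (n) in
/-- Right multiplication of column vectors by `i`. -/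
noncomputable def quatMulI : Module.End ℝ (QuatSpace n) where
  toFun x := WithLp.toLp 2 fun a => x a * quatI
  map_add' x y := by
    ext1 a
    simp [add_mul]
  map_smul' c x := by
    ext1 a
    simp

theorem quatMulI_apply (x : QuatSpace n) (a : Fin n) : quatMulI n x a = x a * quatI := rfl

theorem quatMulI_mul_self (x : QuatSpace n) : quatMulI n (quatMulI n x) = -x := by
  ext1 a
  change x a * quatI * quatI = -(x a)
  rw [mul_assoc, quatI_mul_self, mul_neg, mul_one]

/-- Matrices act from the left and `quatI` from the right, so this is associativity. Right
multiplication by `i` is thus a complex structure respected by the whole group. -/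
theorem quatMulI_commute (A : Matrix (Fin n) (Fin n) ℍ[ℝ]) :
    Commute (quatMulI n) (quatMulVec n A) := by
  refine LinearMap.ext fun x => ?_
  ext1 a
  change (A *ᵥ x.ofLp) a * quatI = (A *ᵥ fun b => x b * quatI) a
  simp only [mulVec, dotProduct, Finset.sum_mul, mul_assoc]

theorem quatMulI_skew (x y : QuatSpace n) :
    ⟪quatMulI n x, y⟫_ℝ = -⟪x, quatMulI n y⟫_ℝ := by
  simp only [PiLp.inner_apply, quatMulI_apply, Quaternion.inner_def, ← Finset.sum_neg_distrib]
  refine Finset.sum_congr rfl fun a _ => ?_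
  rw [star_mul, star_quatI, neg_mul, mul_neg, Quaternion.re_neg, neg_neg, mul_assoc]

variable (n) in
/-- The action of `Sp(n)` on quaternionic column vectors. -/
noncomputable def spHom : Sp n →* Module.End ℝ (QuatSpace n) :=
  (quatMulVec n).comp (unitary (Matrix (Fin n) (Fin n) ℍ[ℝ])).subtype

theorem spHom_apply (g : Sp n) : spHom n g = quatMulVec n g := rfl

theorem coe_sp_inv (g : Sp n) : ((g⁻¹ : Sp n) : Matrix (Fin n) (Fin n) ℍ[ℝ]) =
    (g : Matrix (Fin n) (Fin n) ℍ[ℝ])ᴴ := rfl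

theorem conjTranspose_mul_sp (g : Sp n) :
    (g : Matrix (Fin n) (Fin n) ℍ[ℝ])ᴴ * (g : Matrix (Fin n) (Fin n) ℍ[ℝ]) = 1 :=
  (Unitary.mem_iff.1 g.2).1

theorem mem_sp_of_conjTranspose_mul {A : Matrix (Fin n) (Fin n) ℍ[ℝ]} (hA : Aᴴ * A = 1) :
    A ∈ unitary (Matrix (Fin n) (Fin n) ℍ[ℝ]) :=
  Unitary.mem_iff.2 ⟨hA, mul_eq_one_comm.1 hA⟩

theorem inner_spHom (g : Sp n) (x y : QuatSpace n) :
    ⟪spHom n g x, y⟫_ℝ = ⟪x, spHom n g⁻¹ y⟫_ℝ := by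
  rw [spHom_apply, spHom_apply, coe_sp_inv]
  simp only [PiLp.inner_apply, ofLp_quatMulVec, Quaternion.inner_def, mulVec, dotProduct,
    conjTranspose_apply, star_sum, star_mul, star_star, Finset.sum_mul, Finset.mul_sum]
  have hre : ∀ f : Fin n → ℍ[ℝ], (∑ i, f i).re = ∑ i, (f i).re := fun f =>
    map_sum (QuaternionAlgebra.reₗ (-1 : ℝ) 0 (-1)) f Finset.univ
  simp only [hre]
  rw [Finset.sum_comm]
  refine Finset.sum_congr rfl fun i _ => Finset.sum_congr rfl fun j _ => ?_
  rw [mul_assoc, quaternion_re_mul_comm, mul_assoc]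

/-- Commuting quaternionic unitary matrices have a common eigenvector with complex eigenvalues in
each invariant subspace. -/
theorem exists_sp_eigenvector {T : Subgroup (Sp n)} (hcomm : ∀ s ∈ T, ∀ t ∈ T, s * t = t * s)
    {F : Submodule ℝ (QuatSpace n)} (hF : ∀ t ∈ T, ∀ x ∈ F, spHom n t x ∈ F)
    (hFI : ∀ x ∈ F, quatMulI n x ∈ F) (hne : F ≠ ⊥) :
    ∃ v ∈ F, ‖v‖ = 1 ∧ ∀ t ∈ T, ∃ z : Circle,
      (t : Matrix (Fin n) (Fin n) ℍ[ℝ]) *ᵥ v.ofLp = fun a => v a * circleQuat z := by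
  set ρ := spHom n with hρ
  have hc : ∀ s ∈ T, ∀ t ∈ T, Commute (ρ s) (ρ t) := fun s hs t ht => by
    rw [commute_iff_eq, ← map_mul, ← map_mul, hcomm s hs t ht]
  have hcD : ∀ s ∈ T, ∀ t ∈ T, Commute (ρ s) (ρ t - ρ t⁻¹) := fun s hs t ht =>
    (hc s hs t ht).sub_right (hc s hs _ (T.inv_mem ht))
  have hcDD : ∀ s ∈ T, ∀ t ∈ T, Commute (ρ s - ρ s⁻¹) (ρ t - ρ t⁻¹) := fun s hs t ht =>
    (hcD s hs t ht).sub_left (hcD _ (T.inv_mem hs) t ht)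
  have hcAD : ∀ s ∈ T, ∀ t ∈ T, Commute (ρ s + ρ s⁻¹) (ρ t - ρ t⁻¹) := fun s hs t ht =>
    (hcD s hs t ht).add_left (hcD _ (T.inv_mem hs) t ht)
  have hcAA : ∀ s ∈ T, ∀ t ∈ T, Commute (ρ s + ρ s⁻¹) (ρ t + ρ t⁻¹) := fun s hs t ht =>
    ((hc s hs t ht).add_right (hc s hs _ (T.inv_mem ht))).add_left
      ((hc _ (T.inv_mem hs) t ht).add_right (hc _ (T.inv_mem hs) _ (T.inv_mem ht)))
  have hRA : ∀ t, Commute (quatMulI n) (ρ t + ρ t⁻¹) := fun t =>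
    (quatMulI_commute _).add_right (quatMulI_commute _)
  have hRD : ∀ t, Commute (quatMulI n) (ρ t - ρ t⁻¹) := fun t =>
    (quatMulI_commute _).sub_right (quatMulI_commute _)
  -- Composing the skew operator `ρ t - ρ t⁻¹` with the commuting skew operator `quatMulI n` gives a
  -- symmetric one. An eigenvector of it satisfies `(ρ t - ρ t⁻¹) v = -(b • quatMulI n v)`, so that
  -- `t` acts on `v` by a complex scalar from the right.
  let A : T ⊕ T → Module.End ℝ (QuatSpace n) := Sum.elim (fun t => ρ t + ρ (t : Sp n)⁻¹)
    fun t => quatMulI n * (ρ t - ρ (t : Sp n)⁻¹)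
  obtain ⟨v, hvF, hv1, hv⟩ := exists_common_eigenvector (A := A) (F := F) (by
    rintro (t | t)
    · exact map_add_inv_isSymmetric inner_spHom _
    · intro x y
      change ⟪quatMulI n ((ρ t - ρ (t : Sp n)⁻¹) x), y⟫_ℝ =
        ⟪x, (quatMulI n * (ρ t - ρ (t : Sp n)⁻¹)) y⟫_ℝ
      rw [quatMulI_skew, map_sub_inv_skew inner_spHom, neg_neg, (hRD t).eq]
      rfl) (by
    rintro (t | t) (s | s)
    · exact hcAA t t.2 s s.2
    · exact (hRA t).symm.mul_right (hcAD t t.2 s s.2)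
    · exact (hRA s).mul_left (hcAD s s.2 t t.2).symm
    · exact ((Commute.refl _).mul_right (hRD s)).mul_left
        ((hRD t).symm.mul_right (hcDD t t.2 s s.2))) (by
    rintro (t | t) x hx
    · exact F.add_mem (hF t t.2 x hx) (hF _ (T.inv_mem t.2) x hx)
    · exact hFI _ (F.sub_mem (hF t t.2 x hx) (hF _ (T.inv_mem t.2) x hx))) hne
  refine ⟨v, hvF, hv1, fun t ht => ?_⟩
  obtain ⟨a, ha⟩ := hv (Sum.inl ⟨t, ht⟩)
  obtain ⟨b, hb⟩ := hv (Sum.inr ⟨t, ht⟩)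
  change (ρ t + ρ t⁻¹) v = a • v at ha
  change quatMulI n ((ρ t - ρ t⁻¹) v) = b • v at hb
  have hb' : (ρ t - ρ t⁻¹) v = -(b • quatMulI n v) := by
    rw [← map_smul, ← hb, quatMulI_mul_self, neg_neg]
  have htv : ρ t v = (2⁻¹ * a) • v + (-(2⁻¹ * b)) • quatMulI n v := by
    have half : ρ t v = (2⁻¹ : ℝ) • ((ρ t + ρ t⁻¹) v + (ρ t - ρ t⁻¹) v) := by
      rw [LinearMap.add_apply, LinearMap.sub_apply]
      module
    rw [half, ha, hb']
    module
  have hvv : ⟪v, v⟫_ℝ = 1 := by rw [real_inner_self_eq_norm_sq, hv1, one_pow]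
  have hvR : ⟪v, quatMulI n v⟫_ℝ = 0 := by
    have h1 := quatMulI_skew v v
    rw [real_inner_comm] at h1
    linarith
  have hRR : ⟪quatMulI n v, quatMulI n v⟫_ℝ = 1 := by
    rw [quatMulI_skew, quatMulI_mul_self, inner_neg_right, neg_neg, hvv]
  obtain ⟨z, hz1, hz2⟩ := circle_of_sq_add_sq (a := 2⁻¹ * a) (b := -(2⁻¹ * b)) (by
    have h1 := inner_self_map_eq inner_spHom t v v
    rw [← hρ, htv, inner_add_add_self, hvv] at h1
    simp only [inner_smul_left, inner_smul_right, hvv, hRR, hvR, real_inner_comm v (quatMulI n v),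
      conj_trivial] at h1
    linarith)
  refine ⟨z, ?_⟩
  funext k
  change ρ t v k = _
  rw [htv, ← hz1, ← hz2]
  have h2 : circleQuat z = (z : ℂ).re • (1 : ℍ[ℝ]) + (z : ℂ).im • quatI := by
    ext <;> simp
  rw [h2, mul_add, mul_smul_comm, mul_smul_comm, mul_one]
  rfl

/-- Orthonormal common eigenvectors of commuting quaternionic unitary matrices. -/
theorem exists_sp_orthonormal {T : Subgroup (Sp n)} (hcomm : ∀ s ∈ T, ∀ t ∈ T, s * t = t * s)
    (k : ℕ) (hk : k ≤ n) :
    ∃ u : Fin k → Fin n → ℍ[ℝ], (∀ i j, star (u i) ⬝ᵥ u j = if i = j then 1 else 0) ∧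
      ∀ i, ∀ t ∈ T, ∃ z : Circle,
        (t : Matrix (Fin n) (Fin n) ℍ[ℝ]) *ᵥ u i = fun a => u i a * circleQuat z := by
  induction k with
  | zero => exact ⟨fun i => i.elim0, fun i => i.elim0, fun i => i.elim0⟩
  | succ k ih =>
    obtain ⟨u, hu, hT⟩ := ih (by omega)
    let L : QuatSpace n →ₗ[ℝ] (Fin k → ℍ[ℝ]) :=
      { toFun := fun x i => star (u i) ⬝ᵥ x.ofLp
        map_add' := fun x y => funext fun i => dotProduct_add _ _ _
        map_smul' := fun c x => funext fun i => dotProduct_smul _ _ _ }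
    have hL : ∀ x, x ∈ LinearMap.ker L ↔ ∀ i, star (u i) ⬝ᵥ x.ofLp = 0 := fun x =>
      LinearMap.mem_ker.trans funext_iff
    -- The quaternionic orthogonal complement of `k < n` vectors is cut out by `4 * k` real
    -- equations in real dimension `4 * n`.
    have hne : LinearMap.ker L ≠ ⊥ := by
      apply LinearMap.ker_ne_bot_of_finrank_lt
      rw [LinearEquiv.finrank_eq (WithLp.linearEquiv 2 ℝ (Fin n → ℍ[ℝ])), Module.finrank_pi_fintype,
        Module.finrank_pi_fintype]
      simp only [Finset.sum_const, Finset.card_univ, Fintype.card_fin, smul_eq_mul,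
        Quaternion.finrank_eq_four]
      omega
    obtain ⟨v, hv, hv1, hvT⟩ := exists_sp_eigenvector hcomm (F := LinearMap.ker L) (by
      intro t ht x hx
      rw [hL] at hx ⊢
      intro i
      obtain ⟨z, hz⟩ := hT i _ (T.inv_mem ht)
      -- Taking adjoints of the eigenvector equation for `t⁻¹` shows that the row `star (u i)` is
      -- scaled from the left by `t`. So `t` preserves the vanishing of the products with `u i`.
      have h1 : star (u i) ᵥ* (t : Matrix (Fin n) (Fin n) ℍ[ℝ]) =
          fun a => star (circleQuat z) * star (u i a) := by
        have h2 := congrArg star hz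
        rw [star_mulVec, coe_sp_inv, conjTranspose_conjTranspose] at h2
        rw [h2]
        funext a
        exact star_mul _ _
      rw [spHom_apply, ofLp_quatMulVec, dotProduct_mulVec, h1]
      have h3 := hx i
      simp only [dotProduct, Pi.star_apply] at h3
      simp only [dotProduct, mul_assoc, ← Finset.mul_sum, h3, mul_zero]) (by
      intro x hx
      rw [hL] at hx ⊢
      intro i
      have h3 := hx i
      simp only [dotProduct, Pi.star_apply] at h3
      simp only [dotProduct, Pi.star_apply, quatMulI_apply, ← mul_assoc, ← Finset.sum_mul, h3,
        zero_mul]) hne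
    rw [hL] at hv
    have hvv : star v.ofLp ⬝ᵥ v.ofLp = 1 := by
      have h1 : ⟪v, v⟫_ℝ = 1 := by rw [real_inner_self_eq_norm_sq, hv1, one_pow]
      simp only [PiLp.inner_apply, Quaternion.inner_self] at h1
      simp only [dotProduct, Pi.star_apply, Quaternion.star_mul_self]
      rw [← Quaternion.coe_one, ← h1]
      exact (map_sum (algebraMap ℝ ℍ[ℝ]) _ _).symm
    refine ⟨Fin.cons v.ofLp u, fun i j => ?_, fun i => ?_⟩
    · refine Fin.cases ?_ (fun i => ?_) i <;> refine Fin.cases ?_ (fun j => ?_) j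
      · simpa using hvv
      · have h1 : star v.ofLp ⬝ᵥ u j = star (star (u j) ⬝ᵥ v.ofLp) := by
          rw [star_dotProduct]
        simp [h1, hv j, (Fin.succ_ne_zero j).symm]
      · simpa [Fin.succ_ne_zero] using hv i
      · simpa [Fin.succ_inj] using hu i j
    · refine Fin.cases ?_ (fun i => ?_) i
      · exact hvT
      · exact hT i

/-! ### The standard torus of `Sp(n)` and realization of signed permutations -/

theorem spH_apply (i : Fin n) : spH n i = diagonal (Pi.single i quatI) := rfl

theorem spH_eq (i : Fin n) : spH n i = diagonalAlgHom ℝ (Pi.single i quatI) := rfl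

theorem circleExp_spH (z : Fin n → Circle) :
    circleExp (spH n) z = diagonal fun i => circleQuat (z i) := by
  change circleExp (fun i => diagonalAlgHom ℝ (Pi.single i quatI)) z = _
  rw [circleExp_map]
  refine congrArg diagonal (funext fun k => ?_)
  rw [circleQuat_eq]
  simp only [circleExp, Pi.add_apply, Pi.one_apply, Finset.sum_apply]
  congr 1
  rw [Finset.sum_eq_single k]
  · simp
  · intro j _ hj
    simp [Pi.single_eq_of_ne hj.symm]
  · simp

/-- The standard torus of `Sp(n)` is spanned by the `Hᵢ`. -/
theorem isTorusFrame_spTorus (n : ℕ) :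
    IsTorusFrame (unitary (Matrix (Fin n) (Fin n) ℍ[ℝ])).subtype (spTorus n) (spH n) where
  injective := Subtype.val_injective
  mul_eq_zero i j hij := by
    have h : (Pi.single i quatI : Fin n → ℍ[ℝ]) * Pi.single j quatI = 0 := by
      funext k
      by_cases hk : k = i
      · subst hk
        simp [Pi.single_eq_of_ne hij]
      · simp [Pi.single_eq_of_ne hk]
    rw [spH_eq, spH_eq, ← map_mul, h, map_zero]
  cube i := by
    rw [spH_eq, ← map_mul, ← map_mul, ← map_neg]
    refine congrArg _ (funext fun k => ?_)
    by_cases hk : k = i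
    · subst hk
      simp [quatI_mul_self]
    · simp [Pi.single_eq_of_ne hk]
  ne_zero i h := by
    have h1 := congrFun (congrFun h i) i
    rw [spH_apply, diagonal_apply_eq, Pi.single_eq_same] at h1
    exact quatI_ne_zero h1
  mem_iff g := by
    constructor
    · rintro ⟨θ, hθ⟩
      refine ⟨fun i => Circle.exp (θ i), ?_⟩
      rw [circleExp_spH]
      simp only [expI_eq_circleQuat] at hθ
      exact hθ
    · rintro ⟨z, hz⟩
      choose θ hθ using fun i => exists_expI_eq (z i)
      refine ⟨θ, ?_⟩
      rw [circleExp_spH] at hz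
      simp only [hθ] at hz
      exact hz
  exists_eq z := by
    refine ⟨⟨circleExp (spH n) z, mem_sp_of_conjTranspose_mul ?_⟩, rfl⟩
    rw [circleExp_spH, diagonal_conjTranspose, diagonal_mul_diagonal]
    simp only [Pi.star_apply, star_circleQuat_mul, diagonal_one]
  centralizer g hg := by
    have hentry : ∀ i a b, (g : Matrix (Fin n) (Fin n) ℍ[ℝ]) a b *
        (Pi.single i quatI : Fin n → ℍ[ℝ]) b =
        (Pi.single i quatI : Fin n → ℍ[ℝ]) a * (g : Matrix (Fin n) (Fin n) ℍ[ℝ]) a b := by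
      intro i a b
      have h := congrFun (congrFun (hg i) a) b
      rw [spH_apply, mul_diagonal, diagonal_mul] at h
      exact h
    -- Commutation with the generator at `b` leaves `g a b * quatI = 0`, and the quaternions have no
    -- zero divisors.
    have hoff : ∀ a b, a ≠ b → (g : Matrix (Fin n) (Fin n) ℍ[ℝ]) a b = 0 := by
      intro a b hab
      have h := hentry b a b
      rw [Pi.single_eq_same, Pi.single_eq_of_ne hab, zero_mul] at h
      exact (mul_eq_zero.1 h).resolve_right quatI_ne_zero
    have hdiag : ∀ a, ∃ z, (g : Matrix (Fin n) (Fin n) ℍ[ℝ]) a a = circleQuat z := by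
      intro a
      refine exists_circleQuat_eq (by simpa using hentry a a a) ?_
      have h := congrFun (congrFun (conjTranspose_mul_sp g) a) a
      rw [Matrix.mul_apply, Finset.sum_eq_single a, one_apply_eq, conjTranspose_apply] at h
      · exact h
      · intro b _ hb
        rw [hoff b a hb, mul_zero]
      · simp
    choose z hz using hdiag
    choose θ hθ using fun i => exists_expI_eq (z i)
    refine ⟨θ, ?_⟩
    ext1 a b
    by_cases hab : a = b
    · subst hab
      rw [diagonal_apply_eq, hz, hθ]
    · rw [diagonal_apply_ne _ hab, hoff a b hab]

/-- The quaternion `j` for the sign `-1`, and `1` for the sign `1`. -/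
def signQuat (u : ℤˣ) : ℍ[ℝ] := if u = 1 then 1 else quatJ

theorem star_signQuat_mul (u : ℤˣ) : star (signQuat u) * signQuat u = 1 := by
  rw [Quaternion.star_mul_self]
  rcases Int.units_eq_one_or u with rfl | rfl <;> simp [signQuat, Quaternion.normSq_def']

/-- For the sign `-1` this is `j i = -i j`. The unit quaternion `j` plays the role of the plane
reflection, without any determinant to correct. -/
theorem signQuat_mul_quatI (u : ℤˣ) : signQuat u * quatI = u • quatI * signQuat u := by
  rcases Int.units_eq_one_or u with rfl | rfl
  · simp [signQuat]
  · simp only [signQuat, reduceIte, Units.neg_smul, one_smul, neg_mul, show (-1 : ℤˣ) ≠ 1 by decide]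
    ext
    · rw [Quaternion.re_neg, Quaternion.re_mul, Quaternion.re_mul]; simp
    · rw [Quaternion.imI_neg, Quaternion.imI_mul, Quaternion.imI_mul]; simp
    · rw [Quaternion.imJ_neg, Quaternion.imJ_mul, Quaternion.imJ_mul]; simp
    · rw [Quaternion.imK_neg, Quaternion.imK_mul, Quaternion.imK_mul]; simp

/-- All signed permutations are realized in `Sp(n)`. -/
theorem exists_sp_signed (σ : Equiv.Perm (Fin n)) (ε : Fin n → ℤˣ) :
    ∃ g : Sp n, ∀ i, (g : Matrix (Fin n) (Fin n) ℍ[ℝ]) * spH n i =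
      ε i • spH n (σ i) * (g : Matrix (Fin n) (Fin n) ℍ[ℝ]) := by
  -- A monomial matrix: column `b` has its only nonzero entry in row `σ b`, and this entry is `j`
  -- exactly when the sign is negative.
  let A : Matrix (Fin n) (Fin n) ℍ[ℝ] := Matrix.of fun a b => if a = σ b then signQuat (ε b) else 0
  have hA : Aᴴ * A = 1 := by
    ext1 i j
    rw [Matrix.mul_apply, Finset.sum_eq_single (σ i)]
    · by_cases hij : i = j
      · subst hij
        simp [A, star_signQuat_mul]
      · simp [A, hij]
    · intro a _ ha
      simp [A, ha]
    · simp
  refine ⟨⟨A, mem_sp_of_conjTranspose_mul hA⟩, fun i => ?_⟩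
  change A * spH n i = ε i • spH n (σ i) * A
  have hs : ε i • spH n (σ i) = diagonal (Pi.single (σ i) (ε i • quatI)) := by
    rw [spH_apply]
    rcases Int.units_eq_one_or (ε i) with hε | hε
    · rw [hε, one_smul, one_smul]
    · rw [hε, Units.neg_smul, Units.neg_smul, one_smul, one_smul, Pi.single_neg]
      exact diagonal_neg _
  ext1 a b
  rw [hs, spH_apply, mul_diagonal, diagonal_mul]
  by_cases hab : a = σ b
  · subst hab
    by_cases hb : b = i
    · subst hb
      simpa [A] using signQuat_mul_quatI (ε b)
    · simp [Pi.single_eq_of_ne hb, Pi.single_eq_of_ne (σ.injective.ne hb)]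
  · simp [A, hab]

theorem weylGroupActsAs_spTorus (n : ℕ) :
    WeylGroupActsAs (unitary (Matrix (Fin n) (Fin n) ℍ[ℝ])).subtype (spTorus n) (spH n)
      (signedPerms (spH n)) := by
  rw [← (isTorusFrame_spTorus n).signIndependent.range_perm, ← Set.image_univ]
  exact (isTorusFrame_spTorus n).weylGroupActsAs _ fun x =>
    ⟨fun _ => exists_sp_signed x.1 x.2, fun _ => Set.mem_univ _⟩

/-- The matrix whose columns are `n` orthonormal common eigenvectors is unitary and diagonalizes `T`
with entries in the complex unit circle. -/
theorem exists_conj_mem_spTorus (T : Subgroup (Sp n)) (hT : IsTorus T) :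
    ∃ g : Sp n, ∀ t ∈ T, g⁻¹ * t * g ∈ spTorus n := by
  obtain ⟨u, hu, huT⟩ := exists_sp_orthonormal (T := T)
    (fun s hs t ht => hT.commute hs ht) n le_rfl
  let A : Matrix (Fin n) (Fin n) ℍ[ℝ] := Matrix.of fun a i => u i a
  have hA : Aᴴ * A = 1 := by
    ext1 i j
    rw [one_apply, ← hu i j]
    rfl
  refine ⟨⟨A, mem_sp_of_conjTranspose_mul hA⟩, fun t ht => ?_⟩
  choose z hz using fun i => huT i t ht
  rw [(isTorusFrame_spTorus n).mem_iff]
  refine ⟨z, ?_⟩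
  rw [circleExp_spH]
  change Aᴴ * (t : Matrix (Fin n) (Fin n) ℍ[ℝ]) * A = _
  have h : (t : Matrix (Fin n) (Fin n) ℍ[ℝ]) * A = A * diagonal fun i => circleQuat (z i) := by
    ext1 a i
    rw [mul_diagonal]
    exact congrFun (hz i) a
  rw [Matrix.mul_assoc, h, ← Matrix.mul_assoc, hA, Matrix.one_mul]

end Symplectic

/-! ### Orders, maximality and actions together -/

theorem mainTheorem8 (n : ℕ) (hn : 0 < n) :
    -- the orders, for every choice of the maximal torus
    ((∀ T : Subgroup (SO (2 * n + 1)), IsMaximalTorus T →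
        Nat.card (WeylGroup T) = 2 ^ n * n !) ∧
      (∀ T : Subgroup (Sp n), IsMaximalTorus T →
        Nat.card (WeylGroup T) = 2 ^ n * n !) ∧
      (∀ T : Subgroup (SO (2 * n)), IsMaximalTorus T →
        Nat.card (WeylGroup T) = 2 ^ (n - 1) * n !)) ∧
    -- the standard tori are maximal tori
    (IsMaximalTorus (oddTorus n) ∧ IsMaximalTorus (spTorus n) ∧ IsMaximalTorus (evenTorus n)) ∧
    -- the Weyl groups as groups of signed permutations of the set of all `±H i`
    (WeylGroupActsAs (Matrix.specialOrthogonalGroup (Fin (2 * n + 1)) ℝ).subtype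
        (oddTorus n) (oddH n) (signedPerms (oddH n)) ∧
      WeylGroupActsAs (unitary (Matrix (Fin n) (Fin n) ℍ[ℝ])).subtype
        (spTorus n) (spH n) (signedPerms (spH n)) ∧
      WeylGroupActsAs (Matrix.specialOrthogonalGroup (Fin (2 * n)) ℝ).subtype
        (evenTorus n) (evenH n) (evenSignedPerms (evenH n))) := by
  have hodd := isTorusFrame_oddTorus n
  have hsp := isTorusFrame_spTorus n
  have heven := isTorusFrame_evenTorus n
  refine ⟨⟨fun T hT => ?_, fun T hT => ?_, fun T hT => ?_⟩,
    ⟨hodd.isMaximalTorus .subtypeVal, hsp.isMaximalTorus .subtypeVal,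
      heven.isMaximalTorus .subtypeVal⟩,
    weylGroupActsAs_oddTorus n, weylGroupActsAs_spTorus n, weylGroupActsAs_evenTorus n⟩
  · rw [card_weylGroup_eq_of_conj (hodd.isTorus .subtypeVal) (exists_conj_mem_oddTorus hn) hT,
      (weylGroupActsAs_oddTorus n).card_eq, hodd.signIndependent.card_signedPerms]
  · rw [card_weylGroup_eq_of_conj (hsp.isTorus .subtypeVal) exists_conj_mem_spTorus hT,
      (weylGroupActsAs_spTorus n).card_eq, hsp.signIndependent.card_signedPerms]
  · rw [card_weylGroup_eq_of_conj (heven.isTorus .subtypeVal) (exists_conj_mem_evenTorus hn) hT,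
      (weylGroupActsAs_evenTorus n).card_eq, heven.signIndependent.card_evenSignedPerms hn]
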